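/- \textbf{Syntax.} Fix countably infinite sets $\mathsf{N_C}$, $\mathsf{N_R}$, $\mathsf{N_I}$ of concept, role and individual names (finite binary strings, so that each name has a length). A \emph{role} is $p$ or $p^-$ with $p\in\mathsf{N_R}$, and $(p^-)^-=p$. A TBox is a finite set of axioms of the forms $$A\sqsubseteq A',\quad A\sqsubseteq\exists p,\quad \exists p\sqsubseteq A,\quad p\sqsubseteq s,\quad p\sqsubseteq s^-,\quad \mathbf{disj}(A,A'),\quad \mathbf{disj}(p,p'),\quad r\cdot s\sqsubseteq t,$$ with $A,A'\in\mathsf{N_C}$ and $p,p',r,s,t\in\mathsf{N_R}$; the axioms $r\cdot s\sqsubseteq t$ are called complex role inclusions (CRIs). An ABox is a finite set of assertions $A(a)$, $p(a,b)$ with $a,b\in\mathsf{N_I}$, and a KB is a pair $\mathcal K=(\mathcal T,\mathcal A)$. \textbf{Semantics.} An interpretation $\mathcal I$ has a domain $\Delta\supseteq\mathsf{N_I}$ in which every individual name denotes itself (standard name assumption), and assigns sets $A^{\mathcal I}\subseteq\Delta$ and relations $p^{\mathcal I}\subseteq\Delta\times\Delta$; $(p^-)^{\mathcal I}$ is the converse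 of $p^{\mathcal I}$ and $(\exists p)^{\mathcal I}=\{d\mid \exists d'.\,(d,d')\in p^{\mathcal I}\}$. Inclusions mean $\subseteq$, $\mathbf{disj}$ means disjointness, and $r\cdot s\sqsubseteq t$ means that $(d_1,d_2)\in r^{\mathcal I}$ and $(d_2,d_3)\in s^{\mathcal I}$ imply $(d_1,d_3)\in t^{\mathcal I}$. A KB is consistent if some interpretation (a model) satisfies all its axioms and assertions. An instance query is $q(x)\leftarrow A(x)$ or $q(x,y)\leftarrow p(x,y)$; a tuple $\vec a$ of individuals occurring in $\mathcal A$, of the right length, is a certain answer, $\vec a\in cert(q,\mathcal T,\mathcal A)$, if it is an answer to $q$ in every model of $(\mathcal T,\mathcal A)$. \textbf{Recursion safety.} Let $S$ be a set of roles (the \emph{simple} roles) closed under inverses. $\mathcal T$ is a DL-Lite$^{\mathcal{HR}}$ TBox (with respect to $S$) if for every CRI $r\cdot s\sqsubseteq t\in\mathcal T$ the role $s$ is simple and $t$ is not, and for every $p\sqsubseteq r\in\mathcal T$ with $r$ a role name or an inverse role, if $r$ is simple then so is $p$. The recursion graph of $\mathcal T$ has the concept and role names as nodes, and for each inclusion of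 $\mathcal T$ an edge from the name on its right-hand side to each name on its left-hand side (inverses and $\exists$ are ignored; disjointness axioms give no edges). Let $\sqsubseteq^{\mathsf s}_{\mathcal T}$ be the reflexive and transitive closure of the role inclusions $s_1\sqsubseteq s_2$ of $\mathcal T$ with $s_2$ simple, where an inclusion $s_1\sqsubseteq s_2$ is identified with $s_1^-\sqsubseteq s_2^-$. A DL-Lite$^{\mathcal{HR}}$ TBox $\mathcal T$ is \emph{recursion safe} if every CRI $r_1\cdot s\sqsubseteq r_2\in\mathcal T$ satisfies: (1) every simple directed cycle of the recursion graph through $r_2$ has length at most one, and if there is such a cycle then $r_1=r_2$; (2) there is no axiom $A\sqsubseteq\exists t\in\mathcal T$ with $t\sqsubseteq^{\mathsf s}_{\mathcal T}s$ or $t\sqsubseteq^{\mathsf s}_{\mathcal T}s^-$. A KB is recursion safe if its TBox is, for some set $S$ of simple roles. \textbf{Theorem.} Under a standard injective encoding of inputs as strings over a finite alphabet, the following two problems are solvable on recursion-safe DL-Lite$^{\mathcal{HR}}$ KBs by Turing machines running in time polynomial in the length of the whole input (combined complexity: TBox, ABox, query and tuple are all part of the input): (a) consistency checking: given a recursion-safe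 KB $(\mathcal T,\mathcal A)$, decide whether it is consistent; (b) instance query answering: given a recursion-safe KB $(\mathcal T,\mathcal A)$, an instance query $q$ and a tuple $\vec a$ of individual names, decide whether $\vec a\in cert(q,\mathcal T,\mathcal A)$. The machines depend neither on $\mathcal K$ nor on the set of simple roles. -/

import Mathlib

namespace DLLite

/-! ### Names, roles, axioms, knowledge bases

A name is a finite string of bits. This gives countably infinite sets of concept names, role names
and individual names, and fixes the size of a name as a piece of input. -/

abbrev ConceptName : Type := List Bool
abbrev RoleName : Type := List Bool
abbrev IndName : Type := List Bool

/-- Roles: `p` or `p⁻` for a role name `p`. -/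
inductive Role : Type
  | name (p : RoleName)
  | inv (p : RoleName)

/-- The inverse of a role, with `(p⁻)⁻ = p`. -/
def Role.inverse : Role → Role
  | .name p => .inv p
  | .inv p => .name p

/-- TBox axioms in normal form, and complex role inclusions. -/
inductive TAxiom : Type
  /-- `A ⊑ A'` -/
  | conceptIncl (A A' : ConceptName)
  /-- `A ⊑ ∃p` -/
  | inclEx (A : ConceptName) (p : RoleName)
  /-- `∃p ⊑ A` -/
  | exIncl (p : RoleName) (A : ConceptName)
  /-- `p ⊑ r`, where `r` is a role name `s` or an inverse role `s⁻` -/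
  | roleIncl (p : RoleName) (r : Role)
  /-- `disj(A, A')` -/
  | disjConcept (A A' : ConceptName)
  /-- `disj(p, p')` -/
  | disjRole (p p' : RoleName)
  /-- the complex role inclusion `r · s ⊑ t` -/
  | cri (r s t : RoleName)

/-- ABox assertions `A(a)` and `p(a, b)`. -/
inductive Assertion : Type
  | concept (A : ConceptName) (a : IndName)
  | role (p : RoleName) (a b : IndName)

/-- A TBox is a finite set of axioms, presented by listing its elements. Everything below except the
encoding as a string depends only on the set. -/
abbrev TBox : Type := List TAxiom

/-- An ABox is a finite set of assertions, presented by listing its elements. -/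
abbrev ABox : Type := List Assertion

structure KB : Type where
  tbox : TBox
  abox : ABox

/-- The individuals that occur in an assertion. -/
def Assertion.inds : Assertion → Set IndName
  | .concept _ a => {a}
  | .role _ a b => {a, b}

/-- The individuals that occur in an ABox. -/
def ABox.inds (𝒜 : ABox) : Set IndName := {a | ∃ α ∈ 𝒜, a ∈ α.inds}

/-! ### Semantics -/

/-- An interpretation with domain `Δ`. Under the standard name assumption the individual names are
elements of the domain; here this inclusion is the injection `ind`. -/
structure Interp (Δ : Type) where
  ind : IndName → Δ
  ind_injective : Function.Injective ind
  concept : ConceptName → Set Δ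
  roleName : RoleName → Set (Δ × Δ)

namespace Interp

variable {Δ : Type}

def role (I : Interp Δ) : Role → Set (Δ × Δ)
  | .name p => I.roleName p
  | .inv p => {d | (d.2, d.1) ∈ I.roleName p}

/-- `(∃p)` for a role name `p`. -/
def ex (I : Interp Δ) (p : RoleName) : Set Δ := {d | ∃ d', (d, d') ∈ I.roleName p}

def SatAxiom (I : Interp Δ) : TAxiom → Prop
  | .conceptIncl A A' => I.concept A ⊆ I.concept A'
  | .inclEx A p => I.concept A ⊆ I.ex p
  | .exIncl p A => I.ex p ⊆ I.concept A
  | .roleIncl p r => I.roleName p ⊆ I.role r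
  | .disjConcept A A' => I.concept A ∩ I.concept A' = ∅
  | .disjRole p p' => I.roleName p ∩ I.roleName p' = ∅
  | .cri r s t => ∀ d₁ d₂ d₃ : Δ,
      (d₁, d₂) ∈ I.roleName r → (d₂, d₃) ∈ I.roleName s → (d₁, d₃) ∈ I.roleName t

def SatAssertion (I : Interp Δ) : Assertion → Prop
  | .concept A a => I.ind a ∈ I.concept A
  | .role p a b => (I.ind a, I.ind b) ∈ I.roleName p

/-- `I` is a model of the knowledge base `K`. -/
def IsModel (I : Interp Δ) (K : KB) : Prop :=
  (∀ α ∈ K.tbox, I.SatAxiom α) ∧ (∀ α ∈ K.abox, I.SatAssertion α)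

end Interp

/-- A knowledge base is consistent if it has a model. -/
def KB.Consistent (K : KB) : Prop := ∃ (Δ : Type) (I : Interp Δ), I.IsModel K

/-! ### Instance queries -/

/-- Instance queries `q(x) ← A(x)` and `q(x, y) ← p(x, y)`. -/
inductive InstanceQuery : Type
  | concept (A : ConceptName)
  | role (p : RoleName)

/-- The set of answers to an instance query in an interpretation; tuples are lists. -/
def InstanceQuery.ans {Δ : Type} (I : Interp Δ) : InstanceQuery → Set (List Δ)
  | .concept A => {l | ∃ d, l = [d] ∧ d ∈ I.concept A}
  | .role p => {l | ∃ d d', l = [d, d'] ∧ (d, d') ∈ I.roleName p}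

/-- The number of answer variables. -/
def InstanceQuery.arity : InstanceQuery → ℕ
  | .concept _ => 1
  | .role _ => 2

/-- The certain answers of `q`: the tuples of individuals of the ABox, of the right length, that are
answers to `q` in every model of the knowledge base. -/
def KB.cert (K : KB) (q : InstanceQuery) : Set (List IndName) :=
  {a | a.length = q.arity ∧ (∀ x ∈ a, x ∈ K.abox.inds) ∧
    ∀ (Δ : Type) (I : Interp Δ), I.IsModel K → a.map I.ind ∈ q.ans I}

/-! ### Simple roles and recursion safety -/

/-- A set of simple roles is a set of roles that is closed under inverses. -/
def IsSimpleRoleSet (S : Set Role) : Prop := ∀ r ∈ S, r.inverse ∈ S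

/-- `T` is a DL-Lite^HR TBox with respect to the set `S` of simple roles. -/
def IsHR (S : Set Role) (T : TBox) : Prop :=
  (∀ r s t, TAxiom.cri r s t ∈ T → Role.name s ∈ S ∧ Role.name t ∉ S) ∧
  (∀ p r, TAxiom.roleIncl p r ∈ T → r ∈ S → Role.name p ∈ S)

/-- The role inclusion `r₁ ⊑ r₂` between roles is in `T`, where an inclusion is identified with the
inclusion between the inverse roles. -/
def RoleInclIn (T : TBox) : Role → Role → Prop
  | .name p, r => TAxiom.roleIncl p r ∈ T
  | .inv p, r => TAxiom.roleIncl p r.inverse ∈ T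

/-- The reflexive and transitive closure of the simple inclusions, that is, of the role inclusions
of `T` whose right-hand side is simple. -/
def SimpleSub (S : Set Role) (T : TBox) : Role → Role → Prop :=
  Relation.ReflTransGen fun r₁ r₂ => RoleInclIn T r₁ r₂ ∧ r₂ ∈ S

/-- Nodes of the recursion graph: concept names and role names. -/
inductive Node : Type
  | concept (A : ConceptName)
  | role (p : RoleName)

/-- Edges of the recursion graph of `T`. They lead from the name on the right-hand side of an
inclusion of `T` to the names on its left-hand side. -/
inductive Edge (T : TBox) : Node → Node → Prop
  | conceptIncl {A₁ A₂} : TAxiom.conceptIncl A₁ A₂ ∈ T → Edge T (.concept A₂) (.concept A₁)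
  | roleIncl {t r} : TAxiom.roleIncl t (.name r) ∈ T → Edge T (.role r) (.role t)
  | roleInclInv {r p} : TAxiom.roleIncl r (.inv p) ∈ T → Edge T (.role p) (.role r)
  | inclEx {A r} : TAxiom.inclEx A r ∈ T → Edge T (.role r) (.concept A)
  | exIncl {r A} : TAxiom.exIncl r A ∈ T → Edge T (.concept A) (.role r)
  | criLeft {r s t} : TAxiom.cri r s t ∈ T → Edge T (.role t) (.role r)
  | criRight {r s t} : TAxiom.cri r s t ∈ T → Edge T (.role t) (.role s)

/-- `c` is a (simple directed) cycle of the recursion graph of `T`; its length is its number of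
edges, so a loop is a cycle of length one. -/
def IsCycle (T : TBox) (c : Cycle Node) : Prop :=
  c ≠ Cycle.nil ∧ c.Nodup ∧ c.Chain (Edge T)

/-- `T` is a recursion-safe DL-Lite^HR TBox with respect to the set `S` of simple roles. -/
def IsRecursionSafe (S : Set Role) (T : TBox) : Prop :=
  IsHR S T ∧
  ∀ r₁ s r₂, TAxiom.cri r₁ s r₂ ∈ T →
    (∀ c : Cycle Node, IsCycle T c → Node.role r₂ ∈ c → c.length ≤ 1 ∧ r₁ = r₂) ∧
    ¬ ∃ A t, TAxiom.inclEx A t ∈ T ∧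
      (SimpleSub S T (.name t) (.name s) ∨ SimpleSub S T (.name t) (.inv s))

/-- A recursion-safe DL-Lite^HR knowledge base: one whose TBox is recursion safe with respect to
some set of simple roles. -/
def KB.RecursionSafe (K : KB) : Prop :=
  ∃ S : Set Role, IsSimpleRoleSet S ∧ IsRecursionSafe S K.tbox

/-! ### Encoding of the inputs as strings over a finite alphabet -/

/-- The input alphabet: bits, an end marker, and one tag for each kind of item. -/
inductive Sym : Type
  | bit (b : Bool)
  | mark
  | conceptIncl | inclEx | exIncl | roleIncl | roleInclInv | disjConcept | disjRole | cri
  | conceptAssertion | roleAssertion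
  | conceptQuery | roleQuery
  | ind
  deriving DecidableEq, Fintype

def encodeName (w : List Bool) : List Sym := w.map Sym.bit ++ [Sym.mark]

def encodeAxiom : TAxiom → List Sym
  | .conceptIncl A A' => Sym.conceptIncl :: (encodeName A ++ encodeName A')
  | .inclEx A p => Sym.inclEx :: (encodeName A ++ encodeName p)
  | .exIncl p A => Sym.exIncl :: (encodeName p ++ encodeName A)
  | .roleIncl p (.name s) => Sym.roleIncl :: (encodeName p ++ encodeName s)
  | .roleIncl p (.inv s) => Sym.roleInclInv :: (encodeName p ++ encodeName s)
  | .disjConcept A A' => Sym.disjConcept :: (encodeName A ++ encodeName A')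
  | .disjRole p p' => Sym.disjRole :: (encodeName p ++ encodeName p')
  | .cri r s t => Sym.cri :: (encodeName r ++ (encodeName s ++ encodeName t))

def encodeAssertion : Assertion → List Sym
  | .concept A a => Sym.conceptAssertion :: (encodeName A ++ encodeName a)
  | .role p a b => Sym.roleAssertion :: (encodeName p ++ (encodeName a ++ encodeName b))

def encodeQuery : InstanceQuery → List Sym
  | .concept A => Sym.conceptQuery :: encodeName A
  | .role p => Sym.roleQuery :: encodeName p

def encodeInd (a : IndName) : List Sym := Sym.ind :: encodeName a

/-- The codes of the items of a list one after the other, then an end marker. -/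
def encodeList {α : Type} (enc : α → List Sym) (l : List α) : List Sym :=
  l.flatMap enc ++ [Sym.mark]

def encodeKB (K : KB) : List Sym :=
  encodeList encodeAxiom K.tbox ++ encodeList encodeAssertion K.abox

/-- An input of the instance query answering problem: a knowledge base, an instance query, and a
candidate answer. -/
structure InstanceInput : Type where
  kb : KB
  query : InstanceQuery
  tuple : List IndName

def encodeInstance (i : InstanceInput) : List Sym :=
  encodeKB i.kb ++ (encodeQuery i.query ++ encodeList encodeInd i.tuple)

/-! The encodings are injective, since codes can be read off from the left. -/

def PrefixFree {α : Type} (enc : α → List Sym) : Prop :=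
  ∀ x y u v, enc x ++ u = enc y ++ v → x = y ∧ u = v

theorem PrefixFree.injective {α : Type} {enc : α → List Sym} (h : PrefixFree enc) :
    Function.Injective enc := fun x y hxy => (h x y [] [] (by simp [hxy])).1

theorem prefixFree_name : PrefixFree encodeName := by
  intro x
  induction x with
  | nil => intro y u v h; cases y <;> simp_all [encodeName]
  | cons b x ih =>
    intro y u v h
    cases y with
    | nil => simp [encodeName] at h
    | cons c y =>
      simp only [encodeName, List.map_cons, List.cons_append, List.cons.injEq, Sym.bit.injEq] at h
      obtain ⟨h₁, h₂⟩ := ih y u v h.2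
      simp [h.1, h₁, h₂]

theorem prefixFree_two {x y x' y' : List Bool} {u v : List Sym}
    (h : encodeName x ++ (encodeName y ++ u) = encodeName x' ++ (encodeName y' ++ v)) :
    x = x' ∧ y = y' ∧ u = v := by
  obtain ⟨h₁, h⟩ := prefixFree_name _ _ _ _ h
  exact ⟨h₁, prefixFree_name _ _ _ _ h⟩

theorem prefixFree_axiom : PrefixFree encodeAxiom := by
  intro x y u v h
  rcases x with _ | _ | _ | ⟨_, _ | _⟩ | _ | _ | _ <;>
  rcases y with _ | _ | _ | ⟨_, _ | _⟩ | _ | _ | _ <;>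
  simp only [encodeAxiom, List.cons_append, List.cons.injEq, List.append_assoc, reduceCtorEq,
    false_and, true_and] at h
  case cri.cri =>
    obtain ⟨h₁, h⟩ := prefixFree_name _ _ _ _ h
    obtain ⟨h₂, h₃, h₄⟩ := prefixFree_two h
    simp [h₁, h₂, h₃, h₄]
  all_goals
    obtain ⟨h₁, h₂, h₃⟩ := prefixFree_two h
    simp [h₁, h₂, h₃]

theorem prefixFree_assertion : PrefixFree encodeAssertion := by
  intro x y u v h
  rcases x with _ | _ <;> rcases y with _ | _ <;>
  simp only [encodeAssertion, List.cons_append, List.cons.injEq, List.append_assoc, reduceCtorEq,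
    false_and, true_and] at h
  · obtain ⟨h₁, h₂, h₃⟩ := prefixFree_two h
    simp [h₁, h₂, h₃]
  · obtain ⟨h₁, h⟩ := prefixFree_name _ _ _ _ h
    obtain ⟨h₂, h₃, h₄⟩ := prefixFree_two h
    simp [h₁, h₂, h₃, h₄]

theorem prefixFree_query : PrefixFree encodeQuery := by
  intro x y u v h
  rcases x with _ | _ <;> rcases y with _ | _ <;>
  simp only [encodeQuery, List.cons_append, List.cons.injEq, reduceCtorEq,
    false_and, true_and] at h <;>
  · obtain ⟨h₁, h₂⟩ := prefixFree_name _ _ _ _ h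
    simp [h₁, h₂]

theorem prefixFree_ind : PrefixFree encodeInd := by
  intro x y u v h
  simp only [encodeInd, List.cons_append, List.cons.injEq, true_and] at h
  exact prefixFree_name _ _ _ _ h

theorem PrefixFree.list {α : Type} {enc : α → List Sym} (h : PrefixFree enc)
    (hs : ∀ x u v, enc x ++ u ≠ Sym.mark :: v) : PrefixFree (encodeList enc) := by
  intro x
  induction x with
  | nil =>
    intro y u v e
    cases y with
    | nil => simpa [encodeList] using e
    | cons b y =>
      simp only [encodeList, List.flatMap_nil, List.nil_append, List.singleton_append,
        List.flatMap_cons, List.append_assoc] at e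
      exact absurd e.symm (hs _ _ _)
  | cons a x ih =>
    intro y u v e
    cases y with
    | nil =>
      simp only [encodeList, List.flatMap_nil, List.nil_append, List.singleton_append,
        List.flatMap_cons, List.append_assoc] at e
      exact absurd e (hs _ _ _)
    | cons b y =>
      simp only [encodeList, List.flatMap_cons, List.append_assoc] at e
      obtain ⟨h₁, e⟩ := h _ _ _ _ e
      obtain ⟨h₂, h₃⟩ := ih y u v (by simpa [encodeList] using e)
      simp [h₁, h₂, h₃]

theorem prefixFree_KB : PrefixFree encodeKB := by
  rintro ⟨T, 𝒜⟩ ⟨T', 𝒜'⟩ u v h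
  simp only [encodeKB, List.append_assoc] at h
  obtain ⟨h₁, h⟩ := prefixFree_axiom.list
    (by rintro (_ | _ | _ | ⟨_, _ | _⟩ | _ | _ | _) u v <;> simp [encodeAxiom]) _ _ _ _ h
  obtain ⟨h₂, h⟩ := prefixFree_assertion.list
    (by rintro (_ | _) u v <;> simp [encodeAssertion]) _ _ _ _ h
  simp [h₁, h₂, h]

theorem encodeKB_injective : Function.Injective encodeKB := prefixFree_KB.injective

theorem encodeInstance_injective : Function.Injective encodeInstance := by
  rintro ⟨K, q, a⟩ ⟨K', q', a'⟩ h
  simp only [encodeInstance] at h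
  obtain ⟨h₁, h⟩ := prefixFree_KB _ _ _ _ h
  obtain ⟨h₂, h⟩ := prefixFree_query _ _ _ _ h
  have h₃ := (prefixFree_ind.list (by intro x u v; simp [encodeInd])).injective h
  simp [h₁, h₂, h₃]

/-! ### Polynomial time -/

/-- The problem `P`, restricted to the inputs in `D`, is solvable in polynomial time: a multi-stack
Turing machine that halts after a number of steps polynomial in the length of its input string
computes a Boolean function which agrees with `P` on `D`. -/
def SolvableInPolyTime {α : Type} (enc : α → List Sym) (D P : α → Prop) : Prop :=
  ∃ f : α → Bool,
    Nonempty (Turing.TM2ComputableInPolyTime enc Computability.encodeBool f) ∧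
    ∀ x, D x → (f x = true ↔ P x)

end DLLite

/-! A finite canonical interpretation decides both problems. Its elements are triples of a level, an
individual and a role. Level 0 holds the individuals and level 1 a separate successor for each
individual and role. Deeper existential witnesses are folded into three levels that repeat
cyclically, so only polynomially many facts over the names of the input are possible. `saturation`
closes the assertions under the positive axioms, where `r · s ⊑ t` is applied only if the `s`-edge
joins two individuals.

Completeness: in the interpretation formed by the derived facts, the inclusions other than the CRIs
hold by closure, and the disjointness axioms hold if there is no clash. For `r · s ⊑ t` the role `s`
is simple. Facts about simple roles are never derived by a CRI, so each stems, through simple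
inclusions, from an assertion or from an axiom `A ⊑ ∃t` with `t` below `s` or its inverse. Condition
(2) of recursion safety excludes the latter; hence every `s`-edge joins individuals and the
restricted rule suffices (`simple_of_mem_saturation`, `isModel_interpOfFacts`).

Soundness: folding identifies witnesses that a model may keep apart, so the interpretation need not
map homomorphically into a model. Instead, an element is read as a set of elements of the model
(`Interp.Realizes`) and a connected pair as a set of pairs (`Interp.Linked`). Individuals and their
level 1 successors have exactly one realizer, because a CRI can connect a level 1 element with
several individuals. A deeper element for the role `p` is realized by all `p`-successors, and a tree
edge to it is read as all of `p`. Every derived fact holds of all its realizers, and these exist, so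
every clash is a genuine contradiction (`satisfies_of_mem_saturation`, `clash_eq_false`). Thus
consistency is absence of a clash, and certain answers over a consistent KB are derived facts about
individuals.

Running time: a small functional language on binary trees is compiled to a multi-stack Turing
machine with an explicit bound on the steps (`reach_compile`). `PolyComputable` asks for a program
with polynomial time and polynomial output size; it is closed under composition, pairing, case
distinction and folds whose steps enlarge the state by an amount independent of the state. Parsing,
saturation and the final test are built from these operations. -/

/-! ### Binary trees as a universal data type -/

/-- Binary trees, the values on which the programs below operate. -/
inductive BTree : Type
  | leaf
  | node (a b : BTree)
  deriving DecidableEq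

namespace BTree

/-- The prefix code of a tree. -/
def bits : BTree → List Bool
  | leaf => [false]
  | node a b => true :: (a.bits ++ b.bits)

def size : BTree → ℕ
  | leaf => 1
  | node a b => a.size + b.size + 1

@[simp] theorem length_bits (t : BTree) : t.bits.length = t.size := by
  induction t with
  | leaf => rfl
  | node a b iha ihb => simp [bits, size, iha, ihb]

theorem size_pos (t : BTree) : 0 < t.size := by cases t <;> simp [size]

/-- The code is prefix free, so a tree on top of a stack has a recognizable end and trees can be
stacked without separators. -/
theorem bits_append_inj (t : BTree) :
    ∀ t' u v, t.bits ++ u = t'.bits ++ v → t = t' ∧ u = v := by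
  induction t with
  | leaf => intro t' u v h; cases t' <;> simp_all [bits]
  | node a b iha ihb =>
    intro t' u v h
    cases t' with
    | leaf => simp [bits] at h
    | node a' b' =>
      simp only [bits, List.cons_append, List.append_assoc, List.cons.injEq, true_and] at h
      obtain ⟨h₁, h⟩ := iha _ _ _ h
      obtain ⟨h₂, h⟩ := ihb _ _ _ h
      simp [h₁, h₂, h]

theorem bits_injective : Function.Injective bits := fun t t' h =>
  (bits_append_inj t t' [] [] (by simp [h])).1

/-- The tree of a truth value. -/
def ofBool (b : Bool) : BTree := if b then node leaf leaf else leaf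

theorem ofBool_injective : Function.Injective ofBool := by
  intro a b; cases a <;> cases b <;> simp [ofBool]

end BTree

/-! ### A machine with a stack of trees -/

namespace StackMachine

open Turing

inductive Stk : Type
  | input | main | left | right | count
  deriving DecidableEq

instance : Fintype Stk where
  elems := {.input, .main, .left, .right, .count}
  complete x := by cases x <;> simp

abbrev StkSymbol (α : Type) : Stk → Type
  | .input => α
  | .main | .left | .right | .count => Bool

/-- Three registers: a bit from the main stack or an auxiliary stack, a second bit for the count
stack or the other side of a comparison, and an input symbol. -/
abbrev Var (α : Type) : Type := Option Bool × Option Bool × Option α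

/-- Instructions; the arguments `j` are addresses. -/
inductive Instr : Type
  /-- push a bit on the main stack -/
  | push (b : Bool)
  /-- pop a bit from the main stack, and jump to `j` if it is `false` -/
  | pop (j : ℕ)
  | jump (j : ℕ)
  /-- remove a tree from the main stack, and push its bits on the indicated auxiliary stacks -/
  | scan (toLeft toRight : Bool)
  /-- empty an auxiliary stack, pushing its bits on the main stack if so indicated -/
  | pour (fromRight toMain : Bool)
  /-- compare and remove the contents of the auxiliary stacks; jump to `j` at a difference -/
  | cmp (j : ℕ)
  /-- read the input, building a list of trees on the main stack -/
  | read
  /-- replace the tree of a truth value by this truth value, and halt -/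
  | halt

section

variable {α : Type} {Λ : Type}

abbrev Stm (α Λ : Type) : Type := TM2.Stmt (StkSymbol α) Λ (Var α)

/-- Reset the variables and go on at `l`. -/
def next (l : Λ) : Stm α Λ := .load (fun _ => (none, none, none)) (.goto fun _ => l)

def pushBits (w : List Bool) (q : Stm α Λ) : Stm α Λ :=
  w.foldl (fun q b => .push .main (fun _ => b) q) q

/-- The codes of different symbols may differ in length, hence the case distinction over the
alphabet. The leading `true` makes a node of the new code and the tree already on the stack. -/
def pushCode [DecidableEq α] (code : α → BTree) (l : Λ) : List α → Stm α Λ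
  | [] => next l
  | s :: L => .branch (fun v => decide (v.2.2 = some s))
      (pushBits (true :: (code s).bits) (next l)) (pushCode code l L)

/-- The statement of an instruction, where `i` is its address. -/
noncomputable def stmt [Fintype α] [DecidableEq α] (code : α → BTree) (lab : ℕ → Λ) (i : ℕ) : Instr → Stm α Λ
  | .push b => .push .main (fun _ => b) (next (lab (i + 1)))
  | .pop j => .pop .main (fun v x => (x, v.2))
      (.branch (fun v => v.1 == some true) (next (lab (i + 1))) (next (lab j)))
  | .jump j => next (lab j)
  | .scan ta tb => .pop .main (fun v x => (x, v.2))
      (.branch (fun v => v.1 == some true)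
        (.push .count (fun _ => true)
          (.branch (fun _ => ta)
            (.push .left (fun _ => true)
              (.branch (fun _ => tb) (.push .right (fun _ => true) (next (lab i)))
                (next (lab i))))
            (.branch (fun _ => tb) (.push .right (fun _ => true) (next (lab i)))
                (next (lab i)))))
        (.pop .count (fun v x => (v.1, x, v.2.2))
          (.branch (fun _ => ta)
            (.push .left (fun _ => false)
              (.branch (fun _ => tb)
                (.push .right (fun _ => false)
                  (.branch (fun v => v.2.1.isSome) (next (lab i)) (next (lab (i + 1)))))
                (.branch (fun v => v.2.1.isSome) (next (lab i)) (next (lab (i + 1))))))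
            (.branch (fun _ => tb)
                (.push .right (fun _ => false)
                  (.branch (fun v => v.2.1.isSome) (next (lab i)) (next (lab (i + 1)))))
                (.branch (fun v => v.2.1.isSome) (next (lab i)) (next (lab (i + 1))))))))
  | .pour false tm => .pop .left (fun v x => (x, v.2))
      (.branch (fun v => v.1.isSome)
        (.branch (fun _ => tm) (.push .main (fun v => v.1.getD false) (next (lab i)))
          (next (lab i)))
        (next (lab (i + 1))))
  | .pour true tm => .pop .right (fun v x => (x, v.2))
      (.branch (fun v => v.1.isSome)
        (.branch (fun _ => tm) (.push .main (fun v => v.1.getD false) (next (lab i)))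
          (next (lab i)))
        (next (lab (i + 1))))
  | .cmp j => .pop .left (fun v x => (x, v.2)) (.pop .right (fun v x => (v.1, x, v.2.2))
      (.branch (fun v => v.1 == v.2.1)
        (.branch (fun v => v.1.isSome) (next (lab i)) (next (lab (i + 1))))
        (next (lab j))))
  | .read => .pop .input (fun v x => (v.1, v.2.1, x))
      (.branch (fun v => v.2.2.isSome) (pushCode code (lab i) Finset.univ.toList)
        (next (lab (i + 1))))
  | .halt => .pop .main (fun v x => (x, v.2))
      (.branch (fun v => v.1 == some true)
        -- The two bits still present are the leaves of the tree of `true`.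
        (.pop .main (fun v _ => v) (.pop .main (fun v _ => v)
          (.push .main (fun _ => true) (.load (fun _ => (none, none, none)) .halt))))
        (.push .main (fun _ => false) (.load (fun _ => (none, none, none)) .halt)))

/-- The contents of the stacks. -/
def contents (i : List α) (m a b c : List Bool) : ∀ k, List (StkSymbol α k)
  | .input => i
  | .main => m
  | .left => a
  | .right => b
  | .count => c

section

variable (i : List α) (m a b c : List Bool)

@[simp] theorem contents_input : contents i m a b c .input = i := rfl
@[simp] theorem contents_main : contents i m a b c .main = m := rfl
@[simp] theorem contents_left : contents i m a b c .left = a := rfl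
@[simp] theorem contents_right : contents i m a b c .right = b := rfl
@[simp] theorem contents_count : contents i m a b c .count = c := rfl

@[simp] theorem update_contents_input (x) :
    Function.update (contents i m a b c) .input x = contents x m a b c := by
  funext k; cases k <;> rfl
@[simp] theorem update_contents_main (x) :
    Function.update (contents i m a b c) .main x = contents i x a b c := by
  funext k; cases k <;> rfl
@[simp] theorem update_contents_left (x) :
    Function.update (contents i m a b c) .left x = contents i m x b c := by
  funext k; cases k <;> rfl
@[simp] theorem update_contents_right (x) :
    Function.update (contents i m a b c) .right x = contents i m a x c := by
  funext k; cases k <;> rfl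
@[simp] theorem update_contents_count (x) :
    Function.update (contents i m a b c) .count x = contents i m a b x := by
  funext k; cases k <;> rfl

end

end

/-! ### Running a list of instructions -/

section

variable {α : Type} [Fintype α] [DecidableEq α] (code : α → BTree) (prog : List Instr)

/-- Reduction modulo `prog.length + 1` keeps the set of labels finite; addresses that carry an
instruction are unchanged by it. -/
def label (n : ℕ) : Fin (prog.length + 1) := Fin.ofNat _ n

/-- The transition function of the machine that runs `prog`. -/
noncomputable def machine (l : Fin (prog.length + 1)) : Stm α (Fin (prog.length + 1)) :=
  stmt code (label prog) l.val (prog.getD l.val .halt)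

abbrev Config (α : Type) (prog : List Instr) : Type :=
  TM2.Cfg (StkSymbol α) (Fin (prog.length + 1)) (Var α)

def config (n : ℕ) (i : List α) (m a b c : List Bool) : Config α prog :=
  ⟨some (label prog n), (none, none, none), contents i m a b c⟩

/-- The machine gets from `x` to `y` in at most `n` steps. -/
def Reach (n : ℕ) (x y : Config α prog) : Prop :=
  ∃ k ≤ n, (flip bind (TM2.step (machine code prog)))^[k] (some x) = some y

variable {code prog}

theorem Reach.refl (x : Config α prog) : Reach code prog 0 x x := ⟨0, le_rfl, rfl⟩

theorem Reach.trans {n k : ℕ} {x y z : Config α prog} (h : Reach code prog n x y)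
    (h' : Reach code prog k y z) : Reach code prog (n + k) x z := by
  obtain ⟨n', hn, e⟩ := h
  obtain ⟨k', hk, e'⟩ := h'
  exact ⟨k' + n', by omega, by rw [Function.iterate_add_apply, e, e']⟩

theorem Reach.mono {n k : ℕ} {x y : Config α prog} (h : Reach code prog n x y) (hk : n ≤ k) :
    Reach code prog k x y := by
  obtain ⟨n', hn, e⟩ := h
  exact ⟨n', by omega, e⟩

theorem reach_one {x y : Config α prog} (h : TM2.step (machine code prog) x = some y) :
    Reach code prog 1 x y := ⟨1, le_rfl, by simpa [flip] using h⟩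

theorem label_val {n : ℕ} {c : Instr} (h : prog[n]? = some c) : (label prog n).val = n := by
  have := (List.getElem?_eq_some_iff.1 h).1
  simp only [label, Fin.ofNat]
  exact Nat.mod_eq_of_lt (by omega)

/-- A whole statement is executed in one machine step, so every instruction, and every pass of an
instruction that jumps back to itself, costs one step. -/
theorem reach_instr {n : ℕ} {c : Instr} (h : prog[n]? = some c) {i : List α} {m a b d : List Bool}
    {y : Config α prog}
    (e : TM2.stepAux (stmt code (label prog) n c) (none, none, none) (contents i m a b d) = y) :
    Reach code prog 1 (config prog n i m a b d) y := by
  apply reach_one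
  simp only [config, TM2.step, machine, label_val h, List.getD_eq_getElem?_getD, h,
    Option.getD_some, e]

variable {n : ℕ} {i : List α} {m a b d : List Bool}

theorem reach_push {x : Bool} (h : prog[n]? = some (.push x)) :
    Reach code prog 1 (config prog n i m a b d) (config prog (n + 1) i (x :: m) a b d) :=
  reach_instr h (by simp [stmt, next, config])

theorem reach_pop_true {j : ℕ} (h : prog[n]? = some (.pop j)) :
    Reach code prog 1 (config prog n i (true :: m) a b d) (config prog (n + 1) i m a b d) :=
  reach_instr h (by simp [stmt, next, config])

theorem reach_pop_false {j : ℕ} (h : prog[n]? = some (.pop j)) :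
    Reach code prog 1 (config prog n i (false :: m) a b d) (config prog j i m a b d) :=
  reach_instr h (by simp [stmt, next, config])

theorem reach_jump {j : ℕ} (h : prog[n]? = some (.jump j)) :
    Reach code prog 1 (config prog n i m a b d) (config prog j i m a b d) :=
  reach_instr h (by simp [stmt, next, config])

/-- The count stack holds one entry per subtree still to be read: a node adds an entry for its right
child and a leaf removes one. A scan ends at the leaf that finds the count stack empty. The general
`d` is what the induction needs for left children. -/
theorem reach_scan_aux {ta tb : Bool} (h : prog[n]? = some (.scan ta tb)) (t : BTree) :
    ∀ m a b d, Reach code prog t.size (config prog n i (t.bits ++ m) a b d)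
      (config prog (if d = [] then n + 1 else n) i m (if ta then t.bits.reverse ++ a else a)
        (if tb then t.bits.reverse ++ b else b) d.tail) := by
  induction t with
  | leaf =>
    intro m a b d
    refine reach_instr h ?_
    cases ta <;> cases tb <;> cases d <;> simp [stmt, next, config, BTree.bits]
  | node s t ihs iht =>
    intro m a b d
    have h₁ : Reach code prog 1 (config prog n i ((BTree.node s t).bits ++ m) a b d)
        (config prog n i (s.bits ++ (t.bits ++ m)) (if ta then true :: a else a)
          (if tb then true :: b else b) (true :: d)) := by
      refine reach_instr h ?_
      cases ta <;> cases tb <;> simp [stmt, next, config, BTree.bits]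
    have h₂ := (h₁.trans (ihs _ _ _ _)).trans (by simpa using iht _ _ _ _)
    refine Reach.mono (k := (BTree.node s t).size) ?_ le_rfl
    convert h₂ using 1
    · simp [BTree.size]; omega
    · cases ta <;> cases tb <;> simp [BTree.bits]

theorem reach_scan {ta tb : Bool} (h : prog[n]? = some (.scan ta tb)) (t : BTree) :
    Reach code prog t.size (config prog n i (t.bits ++ m) a b [])
      (config prog (n + 1) i m (if ta then t.bits.reverse ++ a else a)
        (if tb then t.bits.reverse ++ b else b) []) := by
  simpa using reach_scan_aux (code := code) h t m a b []

theorem reach_pour_left {tm : Bool} (h : prog[n]? = some (.pour false tm)) (a : List Bool) :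
    ∀ m, Reach code prog (a.length + 1) (config prog n i m a b d)
      (config prog (n + 1) i (if tm then a.reverse ++ m else m) [] b d) := by
  induction a with
  | nil => intro m; exact reach_instr h (by cases tm <;> simp [stmt, next, config])
  | cons x a ih =>
    intro m
    have h₁ : Reach code prog 1 (config prog n i m (x :: a) b d)
        (config prog n i (if tm then x :: m else m) a b d) :=
      reach_instr h (by cases tm <;> simp [stmt, next, config])
    convert (h₁.trans (ih _)).mono (k := (x :: a).length + 1) (by simp; omega) using 2
    cases tm <;> simp

theorem reach_pour_right {tm : Bool} (h : prog[n]? = some (.pour true tm)) (b : List Bool) :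
    ∀ m, Reach code prog (b.length + 1) (config prog n i m a b d)
      (config prog (n + 1) i (if tm then b.reverse ++ m else m) a [] d) := by
  induction b with
  | nil => intro m; exact reach_instr h (by cases tm <;> simp [stmt, next, config])
  | cons x b ih =>
    intro m
    have h₁ : Reach code prog 1 (config prog n i m a (x :: b) d)
        (config prog n i (if tm then x :: m else m) a b d) :=
      reach_instr h (by cases tm <;> simp [stmt, next, config])
    convert (h₁.trans (ih _)).mono (k := (x :: b).length + 1) (by simp; omega) using 2
    cases tm <;> simp

theorem reach_cmp_eq {j : ℕ} (h : prog[n]? = some (.cmp j)) (a : List Bool) :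
    Reach code prog (a.length + 1) (config prog n i m a a d) (config prog (n + 1) i m [] [] d) := by
  induction a with
  | nil => exact reach_instr h (by simp [stmt, next, config])
  | cons x a ih =>
    have h₁ : Reach code prog 1 (config prog n i m (x :: a) (x :: a) d)
        (config prog n i m a a d) :=
      reach_instr h (by simp [stmt, next, config])
    exact (h₁.trans ih).mono (by simp; omega)

/-- The comparison stops at the first difference. What it leaves on the auxiliary stacks is
immaterial; only the lengths matter, for the cost of emptying them. -/
theorem reach_cmp_ne {j : ℕ} (h : prog[n]? = some (.cmp j)) (a : List Bool) :
    ∀ b, a ≠ b → ∃ a' b', a'.length ≤ a.length ∧ b'.length ≤ b.length ∧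
      Reach code prog (a.length + 1) (config prog n i m a b d) (config prog j i m a' b' d) := by
  induction a with
  | nil =>
    intro b hb
    refine ⟨[], b.tail, by simp, by simp, reach_instr h ?_⟩
    cases b <;> simp_all [stmt, next, config]
  | cons x a ih =>
    intro b hb
    by_cases hx : b.head? = some x
    · cases b with
      | nil => simp at hx
      | cons y b =>
        obtain rfl : y = x := by simpa using hx
        obtain ⟨a', b', ha, hb, hr⟩ := ih b (by simpa using hb)
        refine ⟨a', b', by simp; omega, by simp; omega, ?_⟩
        have h₁ : Reach code prog 1 (config prog n i m (y :: a) (y :: b) d)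
            (config prog n i m a b d) := reach_instr h (by simp [stmt, next, config])
        exact (h₁.trans hr).mono (by simp; omega)
    · refine ⟨a, b.tail, by simp, by simp, (reach_instr h ?_).mono (by simp)⟩
      have : (some x == b.head?) = false := by
        simpa using fun h => hx h.symm
      simp [stmt, next, config, this]

end

end StackMachine

namespace StackMachine

open Turing

/-! ### A functional language on trees -/

/-- Programs that compute a function on trees. -/
inductive Code : Type
  | id
  | leaf
  | fst
  | snd
  /-- is the tree a node with equal children? -/
  | eq
  | comp (f g : Code)
  | pair (f g : Code)
  /-- case distinction on the value of `c` -/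
  | cond (c f g : Code)
  /-- iterate `f` on the right child, as many times as the left child has nodes on its right spine -/
  | iter (f : Code)

namespace Code

def iterate (f : BTree → BTree) : BTree → BTree → BTree
  | .leaf, x => x
  | .node _ n, x => iterate f n (f x)

/-- The summand pays for one pass: unpacking the counter, dropping its left child, swapping counter
and state, running `f`, swapping back and jumping. -/
def iterTime (f : BTree → BTree) (time : BTree → ℕ) : BTree → BTree → ℕ
  | .leaf, _ => 1
  | .node h n, x =>
    (h.size + 4 * n.size + 2 * x.size + 2 * (f x).size + time x + 8) + iterTime f time n (f x)

def eval : Code → BTree → BTree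
  | id, x => x
  | leaf, _ => .leaf
  | fst, .node a _ => a
  | fst, .leaf => .leaf
  | snd, .node _ b => b
  | snd, .leaf => .leaf
  | eq, .node a b => .ofBool (decide (a = b))
  | eq, .leaf => .leaf
  | comp f g, x => f.eval (g.eval x)
  | pair f g, x => .node (f.eval x) (g.eval x)
  | cond c f g, x => match c.eval x with
    | .leaf => g.eval x
    | .node _ _ => f.eval x
  | iter f, .node n x => iterate f.eval n x
  | iter _, .leaf => .leaf

/-- A bound on the number of steps. -/
def time : Code → BTree → ℕ
  | id, _ => 0
  | leaf, x => x.size + 1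
  | fst, x => 4 * x.size + 8
  | snd, x => 4 * x.size + 8
  | eq, x => 4 * x.size + 10
  | comp f g, x => g.time x + f.time (g.eval x)
  | pair f g, x => 5 * x.size + 2 * (g.eval x).size + g.time x + f.time x + 10
  | cond c f g, x => 3 * x.size + (c.eval x).size + c.time x + f.time x + g.time x + 10
  | iter f, .node n x => iterTime f.eval f.time n x + 2
  | iter _, .leaf => 2

/-! ### Compilation -/

def length : Code → ℕ
  | id => 0
  | leaf => 2
  | fst => 8
  | snd => 4
  | eq => 11
  | comp f g => g.length + f.length
  | pair f g => g.length + f.length + 8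
  | cond c f g => c.length + f.length + g.length + 7
  | iter f => f.length + 14

/-- Duplicate the topmost tree of the main stack. -/
def dup : List Instr := [.scan true true, .pour false true, .pour true true]

/-- Swap the two topmost trees of the main stack. -/
def swap : List Instr := [.scan true false, .scan false true, .pour false true, .pour true true]

/-- The instructions of a program, when they are placed at the address `s`. -/
def compile : Code → ℕ → List Instr
  | id, _ => []
  | leaf, _ => [.scan false false, .push false]
  | fst, s => .pop (s + 7) :: (swap ++ [.scan false false, .jump (s + 8), .push false])
  | snd, s => [.pop (s + 3), .scan false false, .jump (s + 4), .push false]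
  | eq, s => [.pop (s + 10), .scan true false, .scan false true, .cmp (s + 8), .push false,
      .push false, .push true, .jump (s + 11), .pour false false, .pour true false, .push false]
  | comp f g, s => g.compile s ++ f.compile (s + g.length)
  | pair f g, s => dup ++ (g.compile (s + 3) ++ (swap ++ (f.compile (s + g.length + 7) ++
      [.push true])))
  | cond c f g, s => dup ++ (c.compile (s + 3) ++
      (.pop (s + c.length + f.length + 7) :: .scan false false :: .scan false false ::
      (f.compile (s + c.length + 6) ++
      .jump (s + c.length + f.length + g.length + 7) ::
      g.compile (s + c.length + f.length + 7))))
  | iter f, s => .pop (s + f.length + 13) :: .pop (s + f.length + 12) :: .scan false false ::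
      (swap ++ (f.compile (s + 7) ++ (swap ++
      [.jump (s + 1), .jump (s + f.length + 14), .push false])))

@[simp] theorem length_dup : dup.length = 3 := rfl

@[simp] theorem length_swap : swap.length = 4 := rfl

theorem length_compile (c : Code) : ∀ s, (c.compile s).length = c.length := by
  induction c <;> intro s <;> simp_all [compile, length] <;> omega

end Code

/-- The instructions `l` occur in `prog` at the address `s`. -/
def At (prog : List Instr) : ℕ → List Instr → Prop
  | _, [] => True
  | s, c :: l => prog[s]? = some c ∧ At prog (s + 1) l

theorem at_cons {prog : List Instr} {s : ℕ} {c l} :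
    At prog s (c :: l) ↔ prog[s]? = some c ∧ At prog (s + 1) l := Iff.rfl

theorem at_append {prog : List Instr} {l l' : List Instr} :
    ∀ {s}, At prog s (l ++ l') ↔ At prog s l ∧ At prog (s + l.length) l' := by
  induction l with
  | nil => simp [At]
  | cons c l ih =>
    intro s
    simp only [List.cons_append, At, ih, List.length_cons, and_assoc]
    rw [show s + 1 + l.length = s + (l.length + 1) by omega]

theorem at_self (l l' : List Instr) : At (l' ++ l) l'.length l := by
  induction l generalizing l' with
  | nil => trivial
  | cons c l ih => exact ⟨by simp, by simpa using ih (l' ++ [c])⟩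

/-! ### Correctness and running time of compiled programs -/

theorem stepAux_pushBits {α Λ : Type} (w : List Bool) : ∀ (q : Stm α Λ) (v) (i : List α) (m a b d),
    TM2.stepAux (pushBits w q) v (contents i m a b d) =
      TM2.stepAux q v (contents i (w ++ m) a b d) := by
  induction w with
  | nil => intros; rfl
  | cons x w ih => intro q v i m a b d; exact (ih _ v i m a b d).trans (by simp)

theorem stepAux_pushCode {α Λ : Type} [DecidableEq α] {code : α → BTree} {l : Λ} {x : α} {v : Var α} (hv : v.2.2 = some x)
    (i : List α) (m a b d) (L : List α) (hx : x ∈ L) :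
    TM2.stepAux (pushCode code l L) v (contents i m a b d) =
      ⟨some l, (none, none, none), contents i (true :: (code x).bits ++ m) a b d⟩ := by
  induction L with
  | nil => simp at hx
  | cons y L ih =>
    by_cases hy : x = y
    · subst hy
      simp [pushCode, hv, stepAux_pushBits, next]
    · simp only [pushCode, TM2.stepAux, hv, Option.some.injEq, hy, decide_false, cond_false]
      exact ih (by simpa [hy] using hx)

section

variable {α : Type} [Fintype α] [DecidableEq α] {code : α → BTree} {prog : List Instr}

variable {s : ℕ} {i : List α} {m : List Bool}

/-- The configuration at the address `n` in which the auxiliary stacks are empty. -/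
abbrev mainConfig (prog : List Instr) (n : ℕ) (i : List α) (m : List Bool) : Config α prog :=
  config prog n i m [] [] []

theorem reach_dup (h : At prog s Code.dup) (t : BTree) :
    Reach code prog (3 * t.size + 2) (mainConfig prog s i (t.bits ++ m))
      (mainConfig prog (s + 3) i (t.bits ++ (t.bits ++ m))) := by
  simp only [Code.dup, At] at h
  obtain ⟨h₁, h₂, h₃, -⟩ := h
  have r₁ := reach_scan (code := code) (i := i) (m := m) (a := []) (b := []) h₁ t
  have r₂ := reach_pour_left (code := code) (i := i) (b := t.bits.reverse) (d := []) h₂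
    t.bits.reverse m
  have r₃ := reach_pour_right (code := code) (i := i) (a := []) (d := []) h₃
    t.bits.reverse (t.bits ++ m)
  simp only [if_true, List.append_nil, List.reverse_reverse] at r₁ r₂ r₃
  exact ((r₁.trans r₂).trans r₃).mono (by simp; omega)

theorem reach_swap (h : At prog s Code.swap) (t u : BTree) :
    Reach code prog (2 * t.size + 2 * u.size + 2) (mainConfig prog s i (t.bits ++ (u.bits ++ m)))
      (mainConfig prog (s + 4) i (u.bits ++ (t.bits ++ m))) := by
  simp only [Code.swap, At] at h
  obtain ⟨h₁, h₂, h₃, h₄, -⟩ := h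
  have r₁ := reach_scan (code := code) (i := i) (m := u.bits ++ m) (a := []) (b := []) h₁ t
  have r₂ := reach_scan (code := code) (i := i) (m := m) (a := t.bits.reverse) (b := []) h₂ u
  have r₃ := reach_pour_left (code := code) (i := i) (b := u.bits.reverse) (d := []) h₃
    t.bits.reverse m
  have r₄ := reach_pour_right (code := code) (i := i) (a := []) (d := []) h₄
    u.bits.reverse (t.bits ++ m)
  simp only [if_true, List.append_nil, List.reverse_reverse, Bool.false_eq_true, if_false]
    at r₁ r₂ r₃ r₄
  exact (((r₁.trans r₂).trans r₃).trans r₄).mono (by simp; omega)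

theorem reach_drop (h : prog[s]? = some (.scan false false)) (t : BTree) :
    Reach code prog t.size (mainConfig prog s i (t.bits ++ m)) (mainConfig prog (s + 1) i m) := by
  simpa using reach_scan (code := code) (i := i) (m := m) (a := []) (b := []) h t

theorem reach_iterate {f : BTree → BTree} {time : BTree → ℕ} {j k : ℕ}
    (h₁ : prog[s]? = some (.pop k)) (h₂ : prog[s + 1]? = some (.scan false false))
    (h₃ : At prog (s + 2) Code.swap)
    (h₄ : ∀ x m, Reach code prog (time x) (mainConfig prog (s + 6) i (x.bits ++ m))
      (mainConfig prog j i ((f x).bits ++ m)))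
    (h₅ : At prog j Code.swap) (h₆ : prog[j + 4]? = some (.jump s)) (n : BTree) :
    ∀ x m, Reach code prog (Code.iterTime f time n x)
      (mainConfig prog s i (n.bits ++ (x.bits ++ m)))
      (mainConfig prog k i ((Code.iterate f n x).bits ++ m)) := by
  induction n with
  | leaf => intro x m; exact reach_pop_false h₁
  | node t n _ ih =>
    intro x m
    have r₁ : Reach code prog 1 (mainConfig prog s i ((BTree.node t n).bits ++ (x.bits ++ m)))
        (mainConfig prog (s + 1) i (t.bits ++ (n.bits ++ (x.bits ++ m)))) := by
      simpa [BTree.bits] using reach_pop_true h₁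
    have r := (((((r₁.trans (reach_drop h₂ t)).trans (reach_swap h₃ n x)).trans
      (h₄ x (n.bits ++ m))).trans (reach_swap h₅ (f x) n)).trans (reach_jump h₆)).trans
      (ih (f x) m)
    exact r.mono (by simp only [Code.iterTime]; omega)

/-- A compiled program computes the function of the program on the topmost tree. -/
theorem reach_compile (c : Code) : ∀ {s : ℕ}, At prog s (c.compile s) →
    ∀ (x : BTree) (m : List Bool), Reach code prog (c.time x) (mainConfig prog s i (x.bits ++ m))
      (mainConfig prog (s + c.length) i ((c.eval x).bits ++ m)) := by
  induction c with
  | id => intro s _ x m; exact Reach.refl _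
  | leaf =>
    intro s h x m
    simp only [Code.compile, At] at h
    exact (reach_drop h.1 x).trans (reach_push h.2.1)
  | fst =>
    intro s h x m
    simp only [Code.compile, at_cons, at_append] at h
    obtain ⟨h₁, h₂, h₃, h₄, h₅, -⟩ := h
    cases x with
    -- Testing for a leaf consumes its only bit, so the leaf is pushed again.
    | leaf => exact ((reach_pop_false h₁).trans (reach_push h₅)).mono (by simp [Code.time])
    | node a b =>
      have r₁ : Reach code prog 1 (mainConfig prog s i ((BTree.node a b).bits ++ m))
          (mainConfig prog (s + 1) i (a.bits ++ (b.bits ++ m))) := by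
        simpa [BTree.bits] using reach_pop_true h₁
      exact (((r₁.trans (reach_swap h₂ a b)).trans (reach_drop h₃ b)).trans
        (reach_jump h₄)).mono (by simp [Code.time, BTree.size]; omega)
  | snd =>
    intro s h x m
    simp only [Code.compile, at_cons] at h
    obtain ⟨h₁, h₂, h₃, h₄, -⟩ := h
    cases x with
    | leaf => exact ((reach_pop_false h₁).trans (reach_push h₄)).mono (by simp [Code.time])
    | node a b =>
      have r₁ : Reach code prog 1 (mainConfig prog s i ((BTree.node a b).bits ++ m))
          (mainConfig prog (s + 1) i (a.bits ++ (b.bits ++ m))) := by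
        simpa [BTree.bits] using reach_pop_true h₁
      exact ((r₁.trans (reach_drop h₂ a)).trans
        (reach_jump h₃)).mono (by simp [Code.time, BTree.size]; omega)
  | eq =>
    intro s h x m
    simp only [Code.compile, at_cons] at h
    obtain ⟨h₁, h₂, h₃, h₄, h₅, h₆, h₇, h₈, h₉, h₁₀, h₁₁, -⟩ := h
    cases x with
    | leaf => exact ((reach_pop_false h₁).trans (reach_push h₁₁)).mono (by simp [Code.time])
    | node a b =>
      have r₁ : Reach code prog 1 (mainConfig prog s i ((BTree.node a b).bits ++ m))
          (mainConfig prog (s + 1) i (a.bits ++ (b.bits ++ m))) := by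
        simpa [BTree.bits] using reach_pop_true h₁
      have r₂ := reach_scan (code := code) (i := i) (m := b.bits ++ m) (a := []) (b := []) h₂ a
      have r₃ := reach_scan (code := code) (i := i) (m := m) (a := a.bits.reverse) (b := []) h₃ b
      simp only [if_true, List.append_nil, Bool.false_eq_true, if_false] at r₂ r₃
      have r := (r₁.trans r₂).trans r₃
      by_cases hab : a = b
      · subst hab
        have r' := ((((r.trans (reach_cmp_eq h₄ _)).trans (reach_push h₅)).trans
          (reach_push h₆)).trans (reach_push h₇)).trans (reach_jump h₈)
        simp only [Code.eval, decide_true, BTree.ofBool, if_true]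
        exact r'.mono (by simp [Code.time, BTree.size]; omega)
      -- Scanning has reversed both codes, which does not affect their equality.
      · obtain ⟨a', b', ha, hb, r'⟩ := reach_cmp_ne (code := code) (i := i) (m := m) (d := []) h₄
          a.bits.reverse b.bits.reverse
          (fun h => hab (BTree.bits_injective (List.reverse_injective h)))
        have r'' := (((r.trans r').trans (reach_pour_left h₉ _ _)).trans
          (reach_pour_right h₁₀ _ _)).trans (reach_push h₁₁)
        simp only [Code.eval, decide_eq_false hab, BTree.ofBool, Bool.false_eq_true, if_false]
          at r'' ⊢
        refine r''.mono ?_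
        simp only [List.length_reverse, BTree.length_bits] at ha hb
        simp [Code.time, BTree.size]
        omega
  | comp f g ihf ihg =>
    intro s h x m
    simp only [Code.compile, at_append, Code.length_compile] at h
    have := (ihg h.1 x m).trans (ihf h.2 _ m)
    rwa [add_assoc] at this
  -- The right component is computed first, on a copy of `x`. The swap brings `x` back to the top
  -- for `f`, and a final `true` joins the two results.
  | pair f g ihf ihg =>
    intro s h x m
    simp only [Code.compile, at_append, Code.length_compile, at_cons, Code.length_dup,
      Code.length_swap] at h
    obtain ⟨h₁, h₂, h₃, h₄, h₅, -⟩ := h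
    have e : s + 3 + g.length + 4 = s + g.length + 7 := by omega
    rw [e] at h₄ h₅
    have r := ((reach_dup (code := code) (i := i) (m := m) h₁ x).trans (ihg h₂ x _)).trans
      (reach_swap h₃ (g.eval x) x)
    rw [e] at r
    have r' := (r.trans (ihf h₄ x _)).trans (reach_push h₅)
    rw [show s + g.length + 7 + f.length + 1 = s + (g.length + f.length + 8) by omega] at r'
    simp only [Code.eval, Code.length, BTree.bits, List.cons_append, List.append_assoc]
    exact r'.mono (by simp only [Code.time]; omega)
  | cond c f g ihc ihf ihg =>
    intro s h x m
    simp only [Code.compile, at_append, Code.length_compile, at_cons, Code.length_dup] at h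
    obtain ⟨h₁, h₂, h₃, h₄, h₅, h₆, h₇, h₈⟩ := h
    rw [show s + 3 + c.length + 1 + 1 + 1 = s + c.length + 6 by omega] at h₆ h₇ h₈
    rw [show s + c.length + 6 + f.length + 1 = s + c.length + f.length + 7 by omega] at h₈
    have r := (reach_dup (code := code) (i := i) (m := m) h₁ x).trans (ihc h₂ x _)
    simp only [Code.eval, Code.length, Code.time]
    cases hc : c.eval x with
    | leaf =>
      rw [hc] at r
      have r' := (r.trans (reach_pop_false h₃)).trans (ihg h₈ x m)
      rw [show s + c.length + f.length + 7 + g.length =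
        s + (c.length + f.length + g.length + 7) by omega] at r'
      exact r'.mono (by omega)
    | node a b =>
      rw [hc] at r
      have r₁ : Reach code prog 1
          (mainConfig prog (s + 3 + c.length) i ((BTree.node a b).bits ++ (x.bits ++ m)))
          (mainConfig prog (s + 3 + c.length + 1) i (a.bits ++ (b.bits ++ (x.bits ++ m)))) := by
        simpa [BTree.bits] using reach_pop_true h₃
      -- Once the root bit has selected the branch, both children of the condition's value are
      -- discarded.
      have r' := ((r.trans r₁).trans (reach_drop h₄ a)).trans (reach_drop h₅ b)
      rw [show s + 3 + c.length + 1 + 1 + 1 = s + c.length + 6 by omega] at r'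
      have r'' := (r'.trans (ihf h₆ x m)).trans (reach_jump h₇)
      rw [show s + c.length + f.length + g.length + 7 =
        s + (c.length + f.length + g.length + 7) by omega] at r''
      exact r''.mono (by simp only [BTree.size]; omega)
  | iter f ih =>
    intro s h x m
    simp only [Code.compile, at_append, Code.length_compile, at_cons, Code.length_swap] at h
    obtain ⟨h₁, h₂, h₃, h₄, h₅, h₆, h₇, h₈, h₉, -⟩ := h
    simp only [add_assoc, Nat.reduceAdd] at h₁ h₂ h₃ h₄ h₅ h₆ h₇ h₈ h₉
    cases x with
    | leaf =>
      have e : s + (f.length + 13) + 1 = s + (Code.iter f).length := by simp only [Code.length]; omega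
      have r := (reach_pop_false (code := code) (i := i) (m := m) (a := []) (b := []) (d := []) h₁)
      have h₉' : prog[s + (f.length + 13)]? = some (.push false) := by
        rw [← h₉]; congr 1; omega
      have r' := r.trans (reach_push h₉')
      rw [e] at r'
      exact r'
    | node n x =>
      have r₁ : Reach code prog 1 (mainConfig prog s i ((BTree.node n x).bits ++ m))
          (mainConfig prog (s + 1) i (n.bits ++ (x.bits ++ m))) := by
        simpa [BTree.bits] using reach_pop_true h₁
      have r₂ := reach_iterate (code := code) (i := i) (j := s + (f.length + 7)) h₂ h₃ h₄
        (f := f.eval) (time := f.time) (fun x m => by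
          have := ih h₅ x m
          rwa [show s + 7 + f.length = s + (f.length + 7) by omega] at this)
        (by rwa [show s + (7 + f.length) = s + (f.length + 7) by omega] at h₆)
        (by rw [← h₇]; congr 1; omega) n x m
      have h₈' : prog[s + (f.length + 12)]? = some (.jump (s + (f.length + 14))) := by
        rw [← h₈]; congr 1; omega
      exact ((r₁.trans r₂).trans (reach_jump h₈')).mono (by simp only [Code.time]; omega)

/-- The list of the codes of the symbols of a string, in reverse order. -/
def listTree (code : α → BTree) (l : List α) : BTree :=
  l.foldl (fun t x => .node (code x) t) .leaf

/-- Each symbol is put in front of the list built so far, so the input arrives in reverse order. -/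
theorem reach_read (h : prog[s]? = some .read) (i : List α) : ∀ t : BTree,
    Reach code prog (i.length + 1) (mainConfig prog s i t.bits)
      (mainConfig prog (s + 1) [] (i.foldl (fun t x => .node (code x) t) t).bits) := by
  induction i with
  | nil => intro t; exact reach_instr h (by simp [stmt, next, config])
  | cons x i ih =>
    intro t
    have r : Reach code prog 1 (mainConfig prog s (x :: i) t.bits)
        (mainConfig prog s i (BTree.node (code x) t).bits) := by
      refine reach_instr h ?_
      simp only [stmt, TM2.stepAux, contents_input, List.head?_cons, Option.isSome_some,
        update_contents_input, List.tail_cons, cond_true]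
      rw [stepAux_pushCode rfl _ _ _ _ _ _ (by simp)]
      simp [config, BTree.bits]
    exact (r.trans (ih _)).mono (by simp; omega)

end

/-- The complete program: read the input, run `c`, and write the answer. -/
def program (c : Code) : List Instr := [.push false, .read] ++ (c.compile 2 ++ [.halt])

theorem reach_program {α : Type} [Fintype α] [DecidableEq α] {code : α → BTree} (c : Code)
    {l : List α} {b : Bool} (h : c.eval (listTree code l) = .ofBool b) :
    Reach code (program c) (l.length + c.time (listTree code l) + 3)
      (mainConfig (program c) 0 l [])
      ⟨none, (none, none, none), contents [] [b] [] [] []⟩ := by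
  have h₁ : (program c)[0]? = some (.push false) := rfl
  have h₂ : (program c)[1]? = some .read := rfl
  have h₃ : At (program c) 2 (c.compile 2 ++ [.halt]) := at_self _ [.push false, .read]
  rw [at_append, Code.length_compile] at h₃
  obtain ⟨h₃, h₄, -⟩ := h₃
  have r₁ : Reach code (program c) 1 (mainConfig (program c) 0 l [])
      (mainConfig (program c) 1 l BTree.leaf.bits) := reach_push h₁
  have r₂ := reach_compile (code := code) (i := ([] : List α)) c h₃ (listTree code l) []
  rw [h] at r₂
  simp only [List.append_nil] at r₂
  have r₃ : Reach code (program c) 1 (mainConfig (program c) (2 + c.length) [] (BTree.ofBool b).bits)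
      ⟨none, (none, none, none), contents [] [b] [] [] []⟩ := by
    refine reach_instr h₄ ?_
    cases b <;> simp [stmt, BTree.ofBool, BTree.bits]
  exact (((r₁.trans (reach_read h₂ l _)).trans r₂).trans r₃).mono (by omega)

/-- The machine that runs a program. -/
noncomputable def turingMachine {α : Type} [Fintype α] [DecidableEq α] (code : α → BTree)
    (c : Code) : FinTM2 where
  K := Stk
  k₀ := .input
  k₁ := .main
  Γ := StkSymbol α
  Λ := Fin ((program c).length + 1)
  main := label (program c) 0
  σ := Var α
  initialState := (none, none, none)
  Γk₀Fin := inferInstanceAs (Fintype α)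
  m := machine code (program c)

/-- A program whose running time is polynomial gives a Turing machine that runs in polynomial
time. -/
theorem computableInPolyTime {α β : Type} [Fintype α] [DecidableEq α] (code : α → BTree)
    (enc : β → List α) (f : β → Bool) (c : Code)
    (hc : ∀ x, c.eval (listTree code (enc x)) = .ofBool (f x)) (P : Polynomial ℕ)
    (hP : ∀ x, c.time (listTree code (enc x)) ≤ P.eval (enc x).length) :
    Nonempty (TM2ComputableInPolyTime enc Computability.encodeBool f) := by
  refine ⟨{ tm := turingMachine code c, inputAlphabet := Equiv.refl α,
            outputAlphabet := Equiv.refl Bool, time := Polynomial.X + P + 3,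
            outputsFun := fun x => ?_ }⟩
  have h := reach_program (code := code) c (hc x)
  choose k hk e using h
  refine ⟨⟨k, ?_⟩, hk.trans ?_⟩
  · have e₁ : initList (turingMachine code c) (List.map (Equiv.refl α).invFun (enc x)) =
        mainConfig (program c) 0 (enc x) [] := by
      simp only [initList, config, turingMachine]
      congr 1
      funext k
      cases k
      · simp only [contents]
        exact List.map_id _
      all_goals rfl
    have e₂ : haltList (turingMachine code c)
        (List.map (Equiv.refl Bool).invFun (Computability.encodeBool (f x))) =
        ⟨none, (none, none, none), contents [] [f x] [] [] []⟩ := by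
      simp only [haltList, turingMachine]
      congr 1
      funext k
      cases k <;> rfl
    rw [e₁]
    exact e.trans (congrArg some e₂.symm)
  · have := hP x
    simp
    omega

end StackMachine

/-! ### Functions computable in polynomial time -/

theorem Polynomial.monotone_eval_nat (P : Polynomial ℕ) : Monotone fun n : ℕ => P.eval n := by
  intro m n h
  induction P using Polynomial.induction_on' with
  | add p q hp hq => simpa using add_le_add hp hq
  | monomial k a => simpa using Nat.mul_le_mul_left a (Nat.pow_le_pow_left h k)

/-- `t` is bounded by a polynomial in `s`. -/
def PolyBounded {α : Type} (s t : α → ℕ) : Prop := ∃ P : Polynomial ℕ, ∀ x, t x ≤ P.eval (s x)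

namespace PolyBounded

variable {α : Type} {s t u : α → ℕ}

theorem self : PolyBounded s s := ⟨Polynomial.X, fun x => by simp⟩

theorem const (n : ℕ) : PolyBounded s fun _ => n := ⟨Polynomial.C n, fun x => by simp⟩

theorem of_le (h : PolyBounded s t) (hu : ∀ x, u x ≤ t x) : PolyBounded s u :=
  ⟨h.choose, fun x => (hu x).trans (h.choose_spec x)⟩

theorem add (h : PolyBounded s t) (h' : PolyBounded s u) : PolyBounded s fun x => t x + u x := by
  obtain ⟨P, hP⟩ := h
  obtain ⟨Q, hQ⟩ := h'
  exact ⟨P + Q, fun x => by simpa using add_le_add (hP x) (hQ x)⟩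

theorem mul (h : PolyBounded s t) (h' : PolyBounded s u) : PolyBounded s fun x => t x * u x := by
  obtain ⟨P, hP⟩ := h
  obtain ⟨Q, hQ⟩ := h'
  exact ⟨P * Q, fun x => by simpa using Nat.mul_le_mul (hP x) (hQ x)⟩

theorem trans (h : PolyBounded s t) (h' : PolyBounded t u) : PolyBounded s u := by
  obtain ⟨P, hP⟩ := h
  obtain ⟨Q, hQ⟩ := h'
  exact ⟨Q.comp P, fun x => by
    simpa using (hQ x).trans (Q.monotone_eval_nat (hP x))⟩

theorem eval (h : PolyBounded s t) (P : Polynomial ℕ) : PolyBounded s fun x => P.eval (t x) :=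
  h.trans ⟨P, fun _ => le_rfl⟩

theorem comp {β : Type} (h : PolyBounded s t) (f : β → α) :
    PolyBounded (fun x => s (f x)) fun x => t (f x) :=
  ⟨h.choose, fun x => h.choose_spec (f x)⟩

end PolyBounded

/-- An encoding of the elements of a type by trees. -/
class TreeEncoding (α : Type) where
  enc : α → BTree
  enc_injective : Function.Injective enc

namespace TreeEncoding

instance : TreeEncoding Bool := ⟨BTree.ofBool, BTree.ofBool_injective⟩

variable {α β : Type} [TreeEncoding α] [TreeEncoding β]

instance : TreeEncoding (α × β) where
  enc x := .node (enc x.1) (enc x.2)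
  enc_injective := by
    rintro ⟨a, b⟩ ⟨a', b'⟩ h
    simp only [BTree.node.injEq] at h
    exact Prod.ext (enc_injective h.1) (enc_injective h.2)

def encList : List α → BTree
  | [] => .leaf
  | a :: l => .node (enc a) (encList l)

instance : TreeEncoding (List α) where
  enc := encList
  enc_injective := by
    intro l
    induction l with
    | nil => intro l' h; cases l' <;> simp_all [encList]
    | cons a l ih =>
      intro l' h
      cases l' with
      | nil => simp [encList] at h
      | cons b l' =>
        simp only [encList, BTree.node.injEq] at h
        rw [enc_injective h.1, ih h.2]

def unary : ℕ → BTree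
  | 0 => .leaf
  | n + 1 => .node .leaf (unary n)

theorem unary_injective : Function.Injective unary := by
  intro m
  induction m with
  | zero => intro n h; cases n <;> simp_all [unary]
  | succ m ih =>
    intro n h
    cases n with
    | zero => simp [unary] at h
    | succ n => simp only [unary, BTree.node.injEq, true_and] at h; rw [ih h]

/-- An encoding of the elements of a finite type. -/
noncomputable abbrev ofFintype (α : Type) [Fintype α] : TreeEncoding α where
  enc x := unary (Fintype.equivFin α x)
  enc_injective _ _ h := (Fintype.equivFin α).injective (Fin.ext (unary_injective h))

/-- The size of the code. -/
def sz (x : α) : ℕ := (enc x).size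

theorem sz_mk (a : α) (b : β) : sz (a, b) = sz a + sz b + 1 := rfl

theorem sz_nil : sz ([] : List α) = 1 := rfl

theorem sz_cons (a : α) (l : List α) : sz (a :: l) = sz a + sz l + 1 := rfl

theorem sz_pos (x : α) : 0 < sz x := BTree.size_pos _

theorem sz_bool (b : Bool) : sz b ≤ 3 := by cases b <;> simp [sz, enc, BTree.ofBool, BTree.size]

theorem length_le_sz (l : List α) : l.length ≤ sz l := by
  induction l with
  | nil => simp
  | cons a l ih => rw [sz_cons, List.length_cons]; omega

theorem sz_le_of_mem {a : α} {l : List α} (h : a ∈ l) : sz a ≤ sz l := by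
  induction l with
  | nil => simp at h
  | cons b l ih =>
    rw [sz_cons]
    rcases List.mem_cons.1 h with rfl | h
    · omega
    · have := ih h; omega

theorem sz_append (l l' : List α) : sz (l ++ l') ≤ sz l + sz l' := by
  induction l with
  | nil => simp
  | cons a l ih => rw [List.cons_append, sz_cons, sz_cons]; omega

theorem sz_filter (p : α → Bool) (l : List α) : sz (l.filter p) ≤ sz l := by
  induction l with
  | nil => simp
  | cons a l ih =>
    rw [List.filter_cons]
    split <;> simp only [sz_cons] <;> omega

end TreeEncoding

open TreeEncoding StackMachine

/-- `f` is computable in polynomial time. -/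
@[fun_prop]
def PolyComputable {α β : Type} [TreeEncoding α] [TreeEncoding β] (f : α → β) : Prop :=
  ∃ c : Code, (∀ x, c.eval (enc x) = enc (f x)) ∧
    PolyBounded (sz : α → ℕ) (fun x => c.time (enc x)) ∧
    PolyBounded (sz : α → ℕ) fun x => sz (f x)

namespace PolyComputable

variable {α β γ σ : Type} [TreeEncoding α] [TreeEncoding β] [TreeEncoding γ] [TreeEncoding σ]

@[fun_prop]
theorem id : PolyComputable fun x : α => x :=
  ⟨.id, fun _ => rfl, PolyBounded.const 0, PolyBounded.self⟩

@[fun_prop]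
theorem comp {f : β → γ} {g : α → β} (hf : PolyComputable f) (hg : PolyComputable g) :
    PolyComputable fun x => f (g x) := by
  obtain ⟨c, hc, tc, sc⟩ := hf
  obtain ⟨d, hd, td, sd⟩ := hg
  refine ⟨.comp c d, fun x => by simp only [Code.eval, hc, hd], ?_, sd.trans (sc.comp g)⟩
  simp only [Code.time, hd]
  exact td.add (sd.trans (tc.comp g))

theorem exists_code_const (t : BTree) : ∃ c : Code, (∀ x, c.eval x = t) ∧
    PolyBounded BTree.size fun x => c.time x := by
  induction t with
  | leaf => exact ⟨.leaf, fun _ => rfl, PolyBounded.self.add (PolyBounded.const 1)⟩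
  | node a b iha ihb =>
    obtain ⟨c, hc, tc⟩ := iha
    obtain ⟨d, hd, td⟩ := ihb
    refine ⟨.pair c d, fun x => by simp [Code.eval, hc, hd], ?_⟩
    simp only [Code.time, hd]
    exact (((((PolyBounded.const 5).mul PolyBounded.self).add (PolyBounded.const _)).add td).add
      tc).add (PolyBounded.const 10)

@[fun_prop]
theorem const (b : β) : PolyComputable fun _ : α => b := by
  obtain ⟨c, hc, tc⟩ := exists_code_const (enc b)
  exact ⟨c, fun _ => hc _, tc.comp enc, PolyBounded.const _⟩

theorem fst' : PolyComputable (Prod.fst : α × β → α) :=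
  ⟨.fst, fun _ => rfl, ((PolyBounded.const 4).mul PolyBounded.self).add (PolyBounded.const 8),
    PolyBounded.self.of_le fun x => by rw [sz_mk]; omega⟩

theorem snd' : PolyComputable (Prod.snd : α × β → β) :=
  ⟨.snd, fun _ => rfl, ((PolyBounded.const 4).mul PolyBounded.self).add (PolyBounded.const 8),
    PolyBounded.self.of_le fun x => by rw [sz_mk]; omega⟩

@[fun_prop]
theorem fst {f : γ → α × β} (hf : PolyComputable f) : PolyComputable fun x => (f x).1 :=
  fst'.comp hf

@[fun_prop]
theorem snd {f : γ → α × β} (hf : PolyComputable f) : PolyComputable fun x => (f x).2 :=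
  snd'.comp hf

@[fun_prop]
theorem mk {f : γ → α} {g : γ → β} (hf : PolyComputable f) (hg : PolyComputable g) :
    PolyComputable fun x => (f x, g x) := by
  obtain ⟨c, hc, tc, sc⟩ := hf
  obtain ⟨d, hd, td, sd⟩ := hg
  refine ⟨.pair c d, fun x => by simp only [Code.eval, hc, hd]; rfl, ?_, ?_⟩
  · simp only [Code.time, hd]
    exact (((((PolyBounded.const 5).mul PolyBounded.self).add
      ((PolyBounded.const 2).mul sd)).add td).add tc).add (PolyBounded.const 10)
  · simp only [sz_mk]
    exact (sc.add sd).add (PolyBounded.const 1)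

-- Comparing codes decides equality of values, because encodings are injective.
@[fun_prop]
theorem beq [BEq β] [LawfulBEq β] {f g : α → β} (hf : PolyComputable f) (hg : PolyComputable g) :
    PolyComputable fun x => f x == g x := by
  have h : PolyComputable fun p : β × β => p.1 == p.2 := by
    refine ⟨.eq, fun p => ?_, ((PolyBounded.const 4).mul PolyBounded.self).add
      (PolyBounded.const 10), (PolyBounded.const 3).of_le fun _ => sz_bool _⟩
    change BTree.ofBool (decide (enc p.1 = enc p.2)) = BTree.ofBool (p.1 == p.2)
    congr 1
    rw [Bool.eq_iff_iff]
    simp [enc_injective.eq_iff]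
  exact h.comp (hf.mk hg)

@[fun_prop]
theorem cond {b : α → Bool} {f g : α → β} (hb : PolyComputable b) (hf : PolyComputable f)
    (hg : PolyComputable g) : PolyComputable fun x => bif b x then f x else g x := by
  obtain ⟨c, hc, tc, sc⟩ := hf
  obtain ⟨d, hd, td, sd⟩ := hg
  obtain ⟨e, he, te, se⟩ := hb
  refine ⟨.cond e c d, fun x => ?_, ?_, (sc.add sd).of_le fun x => ?_⟩
  · simp only [Code.eval, hc, hd, he]
    cases b x <;> rfl
  · simp only [Code.time, he]
    exact ((((((PolyBounded.const 3).mul PolyBounded.self).add se).add te).add tc).add td).add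
      (PolyBounded.const 10)
  · cases hb : b x <;> simp only [hb, cond_true, cond_false] <;> omega

@[fun_prop]
theorem and {f g : α → Bool} (hf : PolyComputable f) (hg : PolyComputable g) :
    PolyComputable fun x => f x && g x := by
  convert hf.cond hg (const false) using 2 with x
  cases f x <;> rfl

@[fun_prop]
theorem or {f g : α → Bool} (hf : PolyComputable f) (hg : PolyComputable g) :
    PolyComputable fun x => f x || g x := by
  convert hf.cond (const true) hg using 2 with x
  cases f x <;> rfl

@[fun_prop]
theorem not {f : α → Bool} (hf : PolyComputable f) : PolyComputable fun x => !f x := by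
  convert hf.cond (const false) (const true) using 2 with x
  cases f x <;> rfl

/-- A finite table is a nest of equality tests against constants. This also makes the choice of code
for a finite type irrelevant. -/
theorem of_fintype [Fintype α] (f : α → β) : PolyComputable f := by
  classical
  rcases isEmpty_or_nonempty α with h | ⟨⟨a⟩⟩
  · exact ⟨.id, isEmptyElim, ⟨0, isEmptyElim⟩, ⟨0, isEmptyElim⟩⟩
  have key : ∀ L : List α, ∃ g : α → β, PolyComputable g ∧ ∀ x ∈ L, g x = f x := by
    intro L
    induction L with
    | nil => exact ⟨fun _ => f a, const _, by simp⟩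
    | cons y L ih =>
      obtain ⟨g, hg, h⟩ := ih
      refine ⟨fun x => bif x == y then f y else g x, by fun_prop, fun x hx => ?_⟩
      by_cases e : x = y
      · simp [e]
      · simp [beq_eq_false_iff_ne.2 e, h x (by simpa [e] using hx)]
  obtain ⟨g, hg, h⟩ := key Finset.univ.toList
  rwa [← show g = f from funext fun x => h x (by simp)]

-- A nonempty list has the same code as the pair of its head and tail, so the program for pairs
-- serves unchanged.
@[fun_prop]
theorem cons {f : γ → α} {g : γ → List α} (hf : PolyComputable f) (hg : PolyComputable g) :
    PolyComputable fun x => f x :: g x := by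
  obtain ⟨c, hc, tc, sc⟩ := hf.mk hg
  exact ⟨c, hc, tc, sc⟩

/-! Folds whose steps increase the size of the state by a polynomial in the other arguments. -/

/-- The list is its own loop counter: the right spine of its code has one node per element. The loop
state carries the environment, the unread part of the list and the accumulator. -/
theorem iterate_fold {step : γ × σ × α → σ} {c : Code}
    (hc : ∀ x : γ × (α × List α) × σ, c.eval (enc x) = enc (x.1, x.2.1.2, step (x.1, x.2.2, x.2.1.1)))
    (e : γ) (l : List α) : ∀ s, Code.iterate c.eval (enc l) (enc (e, l, s)) =
      enc (e, ([] : List α), l.foldl (fun s a => step (e, s, a)) s) := by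
  induction l with
  | nil => intro s; rfl
  | cons a l ih =>
    intro s
    have := hc (e, (a, l), s)
    exact (congrArg (Code.iterate c.eval (enc l)) this).trans (ih _)

/-- `N` bounds the environment and the list, and `S` every accumulator that occurs. The hypothesis
on `S` reserves `Q.eval (2 * N)` for each remaining element and so survives a step. A loop state has
size at most `2 * N + S + 2`; it is counted four times in a pass, beside `4 * N` for the counter. -/
theorem iterTime_fold {step : γ × σ × α → σ} {c : Code}
    (hc : ∀ x : γ × (α × List α) × σ, c.eval (enc x) = enc (x.1, x.2.1.2, step (x.1, x.2.2, x.2.1.1)))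
    {P Q : Polynomial ℕ} (hP : ∀ x : γ × (α × List α) × σ, c.time (enc x) ≤ P.eval (sz x))
    (hQ : ∀ e s a, sz (step (e, s, a)) ≤ sz s + Q.eval (sz e + sz a))
    {N S : ℕ} (e : γ) (he : sz e ≤ N) (l : List α) : ∀ s : σ, sz l ≤ N →
    sz s + l.length * Q.eval (2 * N) ≤ S →
    Code.iterTime c.eval c.time (enc l) (enc (e, l, s)) ≤
      l.length * (12 * N + 4 * S + 16 + P.eval (2 * N + S + 2)) + 1 := by
  induction l with
  | nil => intro s _ _; simp [enc, encList, Code.iterTime]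
  | cons a l ih =>
    intro s hl hs
    have e₁ : c.eval (enc (e, a :: l, s)) = enc (e, l, step (e, s, a)) := hc (e, (a, l), s)
    have e₂ : Code.iterTime c.eval c.time (enc (a :: l)) (enc (e, a :: l, s)) =
        (sz a + 4 * sz l + 2 * sz (e, a :: l, s) + 2 * (c.eval (enc (e, a :: l, s))).size +
          c.time (enc (e, a :: l, s)) + 8) +
        Code.iterTime c.eval c.time (enc l) (c.eval (enc (e, a :: l, s))) := rfl
    rw [e₂, e₁]
    rw [sz_cons] at hl
    rw [List.length_cons, add_one_mul] at hs
    have h₁ : sz (step (e, s, a)) ≤ sz s + Q.eval (2 * N) :=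
      (hQ e s a).trans (Nat.add_le_add_left (Q.monotone_eval_nat (by omega)) _)
    have h₂ := ih (step (e, s, a)) (by omega) (by omega)
    have h₃ : sz (e, a :: l, s) ≤ 2 * N + S + 2 := by
      simp only [sz_mk, sz_cons]; omega
    have h₄ : c.time (enc (e, a :: l, s)) ≤ P.eval (2 * N + S + 2) :=
      (hP (e, (a, l), s)).trans (P.monotone_eval_nat h₃)
    have h₅ : (enc (e, l, step (e, s, a))).size ≤ 2 * N + S + 2 := by
      change sz (e, l, step (e, s, a)) ≤ _
      simp only [sz_mk]; omega
    rw [List.length_cons, add_one_mul]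
    omega

theorem _root_.TreeEncoding.sz_foldl {α σ : Type} [TreeEncoding σ] {f : σ → α → σ} {q : ℕ} (l : List α) : ∀ s,
    (∀ s, ∀ a ∈ l, sz (f s a) ≤ sz s + q) → sz (l.foldl f s) ≤ sz s + l.length * q := by
  induction l with
  | nil => intro s _; simp
  | cons a l ih =>
    intro s h
    have h₁ := ih (f s a) fun s b hb => h s b (List.mem_cons_of_mem _ hb)
    have h₂ := h s a (by simp)
    rw [List.foldl_cons, List.length_cons, add_one_mul]
    omega

/-- The growth bound must not depend on the size of the accumulator: a step that doubled the
accumulator would make it exponential after linearly many steps. -/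
theorem foldl {step : γ × σ × α → σ} {f : γ → List α} {g : γ → σ} (hs : PolyComputable step)
    (hf : PolyComputable f) (hg : PolyComputable g) (Q : Polynomial ℕ)
    (hQ : ∀ e s a, sz (step (e, s, a)) ≤ sz s + Q.eval (sz e + sz a)) :
    PolyComputable fun x => (f x).foldl (fun s a => step (x, s, a)) (g x) := by
  have hG : PolyComputable fun x : γ × (α × List α) × σ =>
      (x.1, x.2.1.2, step (x.1, x.2.2, x.2.1.1)) := by
    have : PolyComputable fun x : γ × (α × List α) × σ => step (x.1, x.2.2, x.2.1.1) :=
      hs.comp (by fun_prop)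
    fun_prop
  obtain ⟨c, hc, ⟨P, hP⟩, -⟩ := hG
  -- The first copy of `f x` is the loop counter, the second is consumed by the steps.
  have key : ∃ d : Code, (∀ x, d.eval (enc (f x, x, f x, g x)) =
      enc (x, ([] : List α), (f x).foldl (fun s a => step (x, s, a)) (g x))) ∧
      PolyBounded sz fun x : γ => d.time (enc (f x, x, f x, g x)) := by
    refine ⟨.iter c, fun x => iterate_fold hc x (f x) (g x), ?_⟩
    obtain ⟨-, -, -, bf⟩ := hf
    obtain ⟨-, -, -, bg⟩ := hg
    let N : γ → ℕ := fun x => sz x + sz (f x)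
    -- The initial accumulator plus the largest growth per step, with the number of steps bounded by
    -- the size of the list.
    let S : γ → ℕ := fun x => sz (g x) + sz (f x) * Q.eval (2 * N x)
    have bN : PolyBounded sz N := PolyBounded.self.add bf
    have bS : PolyBounded sz S := bg.add (bf.mul (((PolyBounded.const 2).mul bN).eval Q))
    have bC : PolyBounded sz fun x => 12 * N x + 4 * S x + 16 + P.eval (2 * N x + S x + 2) :=
      ((((PolyBounded.const 12).mul bN).add ((PolyBounded.const 4).mul bS)).add
        (PolyBounded.const 16)).add
        (((((PolyBounded.const 2).mul bN).add bS).add (PolyBounded.const 2)).eval P)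
    refine (((bf.mul bC).add (PolyBounded.const 1)).add (PolyBounded.const 2)).of_le fun x => ?_
    have hl := length_le_sz (f x)
    refine Nat.add_le_add_right ((iterTime_fold hc (P := P) (Q := Q) hP hQ (N := N x) (S := S x)
      x ?_ (f x) (g x) ?_ ?_).trans (Nat.add_le_add_right (Nat.mul_le_mul_right _ hl) 1)) 2
    · simp only [N]; omega
    · simp only [N]; omega
    · simp only [S]; exact Nat.add_le_add_left (Nat.mul_le_mul_right _ hl) _
  obtain ⟨d, hd, td⟩ := key
  have hin : PolyComputable fun x => (f x, x, f x, g x) := by fun_prop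
  have hout : PolyBounded sz fun x => sz ((f x).foldl (fun s a => step (x, s, a)) (g x)) := by
    obtain ⟨-, -, -, bf⟩ := hf
    obtain ⟨-, -, -, bg⟩ := hg
    refine (bg.add (bf.mul ((PolyBounded.self.add bf).eval Q))).of_le fun x => ?_
    refine (sz_foldl (f x) (g x) (q := Q.eval (sz x + sz (f x))) fun s a ha => ?_).trans
      (Nat.add_le_add_left (Nat.mul_le_mul_right _ (length_le_sz _)) _)
    exact (hQ x s a).trans (Nat.add_le_add_left
      (Q.monotone_eval_nat (Nat.add_le_add_left (sz_le_of_mem ha) _)) _)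
  have hmid : PolyComputable fun x =>
      (x, ([] : List α), (f x).foldl (fun s a => step (x, s, a)) (g x)) := by
    obtain ⟨c', hc', tc', -⟩ := hin
    refine ⟨.comp d c', fun x => by simp only [Code.eval, hc', hd], ?_, ?_⟩
    · simp only [Code.time, hc']
      exact tc'.add td
    · simp only [sz_mk]
      exact (PolyBounded.self.add (((PolyBounded.const _).add hout).add
        (PolyBounded.const 1))).add (PolyBounded.const 1)
  have := hmid.snd.snd
  exact this

/-! ### Polynomial-time list operations -/

theorem reverse {f : γ → List α} (hf : PolyComputable f) :
    PolyComputable fun x => (f x).reverse := by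
  have := foldl (step := fun z : γ × List α × α => z.2.2 :: z.2.1) (g := fun _ => [])
    (by fun_prop) hf (by fun_prop) (Polynomial.X + 1) (fun e s a => by
      simp [sz_cons]; omega)
  have e : ∀ l l' : List α, l.foldl (fun s a => a :: s) l' = l.reverse ++ l' := by simp
  simpa only [e, List.append_nil] using this

theorem foldr {step : γ × σ × α → σ} {f : γ → List α} {g : γ → σ} (hs : PolyComputable step)
    (hf : PolyComputable f) (hg : PolyComputable g) (Q : Polynomial ℕ)
    (hQ : ∀ e s a, sz (step (e, s, a)) ≤ sz s + Q.eval (sz e + sz a)) :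
    PolyComputable fun x => (f x).foldr (fun a s => step (x, s, a)) (g x) := by
  have := foldl hs hf.reverse hg Q hQ
  simpa only [List.foldl_reverse] using this

@[fun_prop]
theorem append {f g : γ → List α} (hf : PolyComputable f) (hg : PolyComputable g) :
    PolyComputable fun x => f x ++ g x := by
  have := foldr (step := fun z : γ × List α × α => z.2.2 :: z.2.1)
    (by fun_prop) hf hg (Polynomial.X + 1) (fun e s a => by simp [sz_cons]; omega)
  simpa using this

theorem any {f : γ → List α} {p : γ → α → Bool} (hf : PolyComputable f)
    (hp : PolyComputable fun z : γ × α => p z.1 z.2) :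
    PolyComputable fun x => (f x).any (p x) := by
  have hs : PolyComputable fun z : γ × Bool × α => p z.1 z.2.2 || z.2.1 :=
    (hp.comp (g := fun z : γ × Bool × α => (z.1, z.2.2)) (by fun_prop)).or (by fun_prop)
  have := foldr hs hf (const false) 3 (fun e s a => by
    have := sz_bool (p e a || s)
    simp; omega)
  convert this using 2 with x
  induction f x with
  | nil => rfl
  | cons a l ih => rw [List.foldr_cons, ← ih, List.any_cons]

theorem filter {f : γ → List α} {p : γ → α → Bool} (hf : PolyComputable f)
    (hp : PolyComputable fun z : γ × α => p z.1 z.2) :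
    PolyComputable fun x => (f x).filter (p x) := by
  have hp' := hp.comp (g := fun z : γ × List α × α => (z.1, z.2.2)) (by fun_prop)
  have hs : PolyComputable fun z : γ × List α × α =>
      bif p z.1 z.2.2 then z.2.2 :: z.2.1 else z.2.1 := by fun_prop
  have := foldr hs hf (const []) (Polynomial.X + 1) (fun e s a => by
    cases p e a <;> simp [sz_cons]; omega)
  convert this using 2 with x
  induction f x with
  | nil => rfl
  | cons a l ih => rw [List.foldr_cons, ← ih, List.filter_cons]; cases p x a <;> rfl

theorem flatMap {f : γ → List α} {h : γ → α → List β} (hf : PolyComputable f)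
    (hh : PolyComputable fun z : γ × α => h z.1 z.2) :
    PolyComputable fun x => (f x).flatMap (h x) := by
  have hh' := hh.comp (g := fun z : γ × List β × α => (z.1, z.2.2)) (by fun_prop)
  have hs : PolyComputable fun z : γ × List β × α => h z.1 z.2.2 ++ z.2.1 := by fun_prop
  -- The output bound of `h` limits the growth per element; `X + 1` accounts for the pair node of
  -- its argument.
  obtain ⟨-, -, -, P, hP⟩ := hh
  have := foldr hs hf (const []) (P.comp (Polynomial.X + 1)) (fun e s a => by
    have h₁ := sz_append (h e a) s
    have h₂ : sz (h e a) ≤ P.eval (sz e + sz a + 1) := hP (e, a)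
    simp
    omega)
  convert this using 2 with x
  induction f x with
  | nil => rfl
  | cons a l ih => rw [List.foldr_cons, ← ih, List.flatMap_cons]

theorem map {f : γ → List α} {h : γ → α → β} (hf : PolyComputable f)
    (hh : PolyComputable fun z : γ × α => h z.1 z.2) :
    PolyComputable fun x => (f x).map (h x) := by
  have := hf.flatMap (h := fun x a => [h x a]) (by fun_prop)
  simpa [List.map_eq_flatMap] using this

/-- A Boolean function of strings that is computable in polynomial time is computed by a Turing
machine in polynomial time. -/
theorem computableInPolyTime {ι : Type} [Fintype α] [DecidableEq α] {p : List α → Bool}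
    (hp : PolyComputable p) (e : ι → List α) :
    Nonempty (Turing.TM2ComputableInPolyTime e Computability.encodeBool fun x => p (e x)) := by
  obtain ⟨c, hc, ⟨P, hP⟩, -⟩ := hp.comp (reverse id)
  have hl : ∀ l : List α, listTree enc l = enc l.reverse := by
    intro l
    have : ∀ l' : List α, l.foldl (fun t x => .node (enc x) t) (enc l') =
        enc (l.reverse ++ l') := by
      induction l with
      | nil => simp
      | cons a l ih => intro l'; rw [List.reverse_cons, List.append_assoc]; exact ih (a :: l')
    have := this []
    rwa [List.append_nil] at this
  -- Over a finite alphabet, the size of the code of a string is linear in its length, so bounds in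
  -- the size become bounds in the input length.
  obtain ⟨K, hK⟩ : ∃ K, ∀ a : α, sz a ≤ K :=
    ⟨Finset.univ.sup sz, fun a => Finset.le_sup (Finset.mem_univ a)⟩
  have hsz : ∀ l : List α, sz l ≤ (K + 1) * l.length + 1 := by
    intro l
    induction l with
    | nil => simp [sz_nil]
    | cons a l ih =>
      have := hK a
      rw [sz_cons, List.length_cons, mul_add]
      omega
  refine StackMachine.computableInPolyTime enc e _ c (fun x => ?_)
    (P.comp (Polynomial.C (K + 1) * Polynomial.X + 1)) fun x => ?_
  · rw [hl, hc]; simp only [List.reverse_reverse]; rfl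
  · rw [hl]
    refine (hP _).trans ?_
    simp only [Polynomial.eval_comp]
    refine P.monotone_eval_nat ((hsz _).trans ?_)
    simp

end PolyComputable

/-! ### The decision procedures -/

namespace DLLite

/-- The items of an input: a tag and up to three names. -/
abbrev Item : Type := Sym × List Bool × List Bool × List Bool

/-- The elements of the canonical model. They have a level, an individual and a role. The elements
of level `0` are the individuals, those of level `1` are the successors of individuals, and the
successors of all other elements are shared witnesses of the existential axioms, whose levels
`2`, `3`, `4` repeat cyclically. -/
abbrev Element : Type := Fin 5 × List Bool × List Bool

/-- A fact says that an element belongs to a concept (in this case it is repeated), or that a pair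
of elements belongs to a role. -/
abbrev Fact : Type := Bool × List Bool × Element × Element

def Element.ind (a : List Bool) : Element := (0, a, [])

/-- The cycle has length three so that the levels of two neighbours tell which is the parent. With
period two, elements could be each other's child; the facts of two unrelated edges would then meet
on one pair and could clash spuriously. -/
def nextLevel : Fin 5 → Fin 5 := ![1, 2, 3, 4, 2]

/-- The successor of an element for a role. -/
def Element.child (x : Element) (p : List Bool) : Element := (nextLevel x.1, x.2.1, p)

/-- The item is an assertion of the fact. -/
def asserts (it : Item) (φ : Fact) : Bool :=
  (it.1 == .conceptAssertion &&
    φ == (false, it.2.1, Element.ind it.2.2.1, Element.ind it.2.2.1)) ||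
  (it.1 == .roleAssertion && φ == (true, it.2.1, Element.ind it.2.2.1, Element.ind it.2.2.2))

/-- The fact `φ` follows from `ψ` and `ψ'` by an axiom. Complex role inclusions are used only when
the second role connects individuals. -/
def entails (it : Item) (ψ ψ' φ : Fact) : Bool :=
  (it.1 == .conceptIncl && ψ.1 == false && ψ.2.1 == it.2.1 && φ == (false, it.2.2.1, ψ.2.2)) ||
  (it.1 == .inclEx && ψ.1 == false && ψ.2.1 == it.2.1 &&
    φ == (true, it.2.2.1, ψ.2.2.1, Element.child ψ.2.2.1 it.2.2.1)) ||
  (it.1 == .exIncl && ψ.1 == true && ψ.2.1 == it.2.1 &&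
    φ == (false, it.2.2.1, ψ.2.2.1, ψ.2.2.1)) ||
  (it.1 == .roleIncl && ψ.1 == true && ψ.2.1 == it.2.1 && φ == (true, it.2.2.1, ψ.2.2)) ||
  (it.1 == .roleInclInv && ψ.1 == true && ψ.2.1 == it.2.1 &&
    φ == (true, it.2.2.1, ψ.2.2.2, ψ.2.2.1)) ||
  (it.1 == .cri && ψ.1 == true && ψ.2.1 == it.2.1 && ψ'.1 == true && ψ'.2.1 == it.2.2.1 &&
    ψ.2.2.2 == ψ'.2.2.1 && ψ'.2.2.1.1 == 0 && ψ'.2.2.2.1 == 0 &&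
    φ == (true, it.2.2.2, ψ.2.2.1, ψ'.2.2.2))

/-- The facts `ψ` and `ψ'` contradict a disjointness axiom. -/
def conflicts (it : Item) (ψ ψ' : Fact) : Bool :=
  (it.1 == .disjConcept && ψ.1 == false && ψ.2.1 == it.2.1 && ψ' == (false, it.2.2.1, ψ.2.2)) ||
  (it.1 == .disjRole && ψ.1 == true && ψ.2.1 == it.2.1 && ψ' == (true, it.2.2.1, ψ.2.2))

/-- The empty name is included because it is the role component of the individuals. -/
def itemNames (its : List Item) : List (List Bool) :=
  [] :: its.flatMap fun it => [it.2.1, it.2.2.1, it.2.2.2]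

def allElements (N : List (List Bool)) : List Element :=
  [0, 1, 2, 3, 4].flatMap fun k => N.flatMap fun a => N.map fun p => (k, a, p)

def allFacts (N : List (List Bool)) : List Fact :=
  [false, true].flatMap fun b => N.flatMap fun A =>
    (allElements N).flatMap fun x => (allElements N).map fun y => (b, A, x, y)

def derivable (its : List Item) (F : List Fact) (φ : Fact) : Bool :=
  its.any (fun it => asserts it φ) ||
  its.any fun it => F.any fun ψ => F.any fun ψ' => entails it ψ ψ' φ

/-- The facts that follow from those in `F` in one step. -/
def consequences (its : List Item) (F : List Fact) : List Fact :=
  (allFacts (itemNames its)).filter (derivable its F)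

/-- The facts that hold in the canonical model. -/
def saturation (its : List Item) : List Fact :=
  (allFacts (itemNames its)).foldl (fun F _ => consequences its F) []

def clash (its : List Item) (F : List Fact) : Bool :=
  its.any fun it => F.any fun ψ => F.any fun ψ' => conflicts it ψ ψ'

/-- The individual occurs in an assertion. -/
def occurs (its : List Item) (a : List Bool) : Bool :=
  its.any fun it => (it.1 == .conceptAssertion && it.2.2.1 == a) ||
    (it.1 == .roleAssertion && (it.2.2.1 == a || it.2.2.2 == a))

def queryInds (its : List Item) : List (List Bool) :=
  (its.filter fun it => it.1 == .ind).map fun it => it.2.1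

/-- A clash means that there is no model, so every tuple of ABox individuals of the right length is
then certain. -/
def answer (its : List Item) (F : List Fact) (as : List (List Bool)) : Bool :=
  its.any fun q =>
    (q.1 == .conceptQuery && as.any fun a => as == [a] && occurs its a &&
      (clash its F || F.any fun φ => φ == (false, q.2.1, Element.ind a, Element.ind a))) ||
    (q.1 == .roleQuery && as.any fun a => as.any fun b => as == [a, b] && occurs its a &&
      occurs its b &&
      (clash its F || F.any fun φ => φ == (true, q.2.1, Element.ind a, Element.ind b)))

/-! Parsing, from the end of the string: the state consists of the items that have been read and
of the last three names. -/

def Sym.isBit : Sym → Bool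
  | .bit _ => true
  | _ => false

def Sym.value : Sym → Bool
  | .bit b => b
  | _ => false

/-- The number of names of an item. -/
def Sym.arity : Sym → ℕ
  | .conceptQuery | .roleQuery | .ind => 1
  | .cri | .roleAssertion => 3
  | _ => 2

abbrev ParserState : Type := List Item × List Bool × List Bool × List Bool

def parseStep (x : Sym) (s : ParserState) : ParserState :=
  bif x.isBit then (s.1, x.value :: s.2.1, s.2.2.1, s.2.2.2)
  else bif x == .mark then (s.1, [], s.2.1, s.2.2.1)
  else ((x, s.2.1, (bif decide (2 ≤ x.arity) then s.2.2.1 else []),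
    (bif decide (3 ≤ x.arity) then s.2.2.2 else [])) :: s.1, [], [], [])

def parseFrom (l : List Sym) (s : ParserState) : ParserState := l.foldr parseStep s

def parse (l : List Sym) : List Item := (parseFrom l ([], [], [], [])).1

/-! ### The running time of the decision procedures -/

noncomputable instance : TreeEncoding Sym := TreeEncoding.ofFintype Sym
noncomputable instance {n : ℕ} : TreeEncoding (Fin n) := TreeEncoding.ofFintype (Fin n)

open TreeEncoding

section

variable {γ : Type} [TreeEncoding γ]

@[fun_prop]
theorem polyComputable_elementInd {f : γ → List Bool} (hf : PolyComputable f) :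
    PolyComputable fun x => Element.ind (f x) := by
  unfold Element.ind; fun_prop

theorem polyComputable_nextLevel : PolyComputable nextLevel := PolyComputable.of_fintype _

@[fun_prop]
theorem polyComputable_child {f : γ → Element} {g : γ → List Bool} (hf : PolyComputable f)
    (hg : PolyComputable g) : PolyComputable fun x => Element.child (f x) (g x) := by
  have := polyComputable_nextLevel.comp hf.fst
  unfold Element.child
  fun_prop

@[fun_prop]
theorem polyComputable_asserts {f : γ → Item} {φ : γ → Fact} (hf : PolyComputable f)
    (hφ : PolyComputable φ) : PolyComputable fun x => asserts (f x) (φ x) := by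
  unfold asserts; fun_prop

@[fun_prop]
theorem polyComputable_entails {f : γ → Item} {ψ ψ' φ : γ → Fact} (hf : PolyComputable f)
    (hψ : PolyComputable ψ) (hψ' : PolyComputable ψ') (hφ : PolyComputable φ) :
    PolyComputable fun x => entails (f x) (ψ x) (ψ' x) (φ x) := by
  unfold entails; fun_prop

@[fun_prop]
theorem polyComputable_conflicts {f : γ → Item} {ψ ψ' : γ → Fact} (hf : PolyComputable f)
    (hψ : PolyComputable ψ) (hψ' : PolyComputable ψ') :
    PolyComputable fun x => conflicts (f x) (ψ x) (ψ' x) := by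
  unfold conflicts; fun_prop

@[fun_prop]
theorem polyComputable_itemNames {f : γ → List Item} (hf : PolyComputable f) :
    PolyComputable fun x => itemNames (f x) :=
  (PolyComputable.const []).cons (hf.flatMap (h := fun _ it => [it.2.1, it.2.2.1, it.2.2.2])
    (by fun_prop))

@[fun_prop]
theorem polyComputable_allElements {f : γ → List (List Bool)} (hf : PolyComputable f) :
    PolyComputable fun x => allElements (f x) := by
  refine (PolyComputable.const [0, 1, 2, 3, 4]).flatMap ?_
  refine PolyComputable.flatMap (by fun_prop) ?_
  exact PolyComputable.map (by fun_prop) (by fun_prop)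

@[fun_prop]
theorem polyComputable_allFacts {f : γ → List (List Bool)} (hf : PolyComputable f) :
    PolyComputable fun x => allFacts (f x) := by
  refine (PolyComputable.const [false, true]).flatMap ?_
  refine PolyComputable.flatMap (by fun_prop) ?_
  refine PolyComputable.flatMap (by fun_prop) ?_
  exact PolyComputable.map (by fun_prop) (by fun_prop)

@[fun_prop]
theorem polyComputable_derivable {f : γ → List Item} {F : γ → List Fact} {φ : γ → Fact}
    (hf : PolyComputable f) (hF : PolyComputable F) (hφ : PolyComputable φ) :
    PolyComputable fun x => derivable (f x) (F x) (φ x) := by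
  refine PolyComputable.or (hf.any (by fun_prop)) (hf.any ?_)
  refine PolyComputable.any (by fun_prop) ?_
  exact PolyComputable.any (by fun_prop) (by fun_prop)

@[fun_prop]
theorem polyComputable_consequences {f : γ → List Item} {F : γ → List Fact}
    (hf : PolyComputable f) (hF : PolyComputable F) :
    PolyComputable fun x => consequences (f x) (F x) :=
  PolyComputable.filter (by fun_prop) (by fun_prop)

/-- Each round yields a sublist of all possible facts, so its size has a polynomial bound in the
items alone, whatever the previous round was. This gives the growth bound that folds require. -/
theorem polyComputable_saturation : PolyComputable saturation := by
  have h : PolyComputable fun its => allFacts (itemNames its) := by fun_prop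
  obtain ⟨-, -, -, P, hP⟩ := h
  exact PolyComputable.foldl (γ := List Item)
    (step := fun z : List Item × List Fact × Fact => consequences z.1 z.2.1)
    (by fun_prop) (by fun_prop) (by fun_prop) P fun its F _ =>
      ((sz_filter _ _).trans ((hP its).trans (P.monotone_eval_nat (by omega)))).trans
        (Nat.le_add_left _ _)

@[fun_prop]
theorem polyComputable_clash {f : γ → List Item} {F : γ → List Fact}
    (hf : PolyComputable f) (hF : PolyComputable F) :
    PolyComputable fun x => clash (f x) (F x) := by
  refine PolyComputable.any (by fun_prop) ?_
  refine PolyComputable.any (by fun_prop) ?_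
  exact PolyComputable.any (by fun_prop) (by fun_prop)

@[fun_prop]
theorem polyComputable_occurs {f : γ → List Item} {a : γ → List Bool}
    (hf : PolyComputable f) (ha : PolyComputable a) :
    PolyComputable fun x => occurs (f x) (a x) :=
  PolyComputable.any (by fun_prop) (by fun_prop)

theorem polyComputable_queryInds : PolyComputable queryInds :=
  (PolyComputable.id.filter (p := fun (_ : List Item) (it : Item) => it.1 == .ind)
    (by fun_prop)).map (h := fun (_ : List Item) (it : Item) => it.2.1) (by fun_prop)

theorem polyComputable_answer {f : γ → List Item} {F : γ → List Fact} {as : γ → List (List Bool)}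
    (hf : PolyComputable f) (hF : PolyComputable F) (ha : PolyComputable as) :
    PolyComputable fun x => answer (f x) (F x) (as x) := by
  refine PolyComputable.any (by fun_prop) (PolyComputable.or (PolyComputable.and (by fun_prop) ?_)
    (PolyComputable.and (by fun_prop) ?_))
  · refine PolyComputable.any (by fun_prop) (PolyComputable.and (by fun_prop)
      (PolyComputable.or (by fun_prop) ?_))
    exact PolyComputable.any (by fun_prop) (by fun_prop)
  · refine PolyComputable.any (by fun_prop) ?_
    refine PolyComputable.any (by fun_prop) (PolyComputable.and (by fun_prop)
      (PolyComputable.or (by fun_prop) ?_))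
    exact PolyComputable.any (by fun_prop) (by fun_prop)

end

theorem polyComputable_parse : PolyComputable parse := by
  have h₁ : PolyComputable Sym.isBit := PolyComputable.of_fintype _
  have h₂ : PolyComputable Sym.value := PolyComputable.of_fintype _
  have h₃ : PolyComputable fun x : Sym => decide (2 ≤ x.arity) := PolyComputable.of_fintype _
  have h₄ : PolyComputable fun x : Sym => decide (3 ≤ x.arity) := PolyComputable.of_fintype _
  have hs : PolyComputable fun z : List Sym × ParserState × Sym => parseStep z.2.2 z.2.1 := by
    have h₃' := h₃.comp (g := fun z : List Sym × ParserState × Sym => z.2.2) (by fun_prop)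
    have h₄' := h₄.comp (g := fun z : List Sym × ParserState × Sym => z.2.2) (by fun_prop)
    unfold parseStep
    fun_prop
  have := PolyComputable.foldr hs PolyComputable.id
    (PolyComputable.const (([], [], [], []) : ParserState)) (Polynomial.X + 10) (fun e s x => by
      rcases s with ⟨its, a, b, c⟩
      have ha := sz_pos a
      have hb := sz_pos b
      have hc := sz_pos c
      have hx := sz_bool x.value
      simp only [parseStep, Polynomial.eval_add, Polynomial.eval_X, Polynomial.eval_ofNat]
      cases x.isBit <;> cases x == .mark <;> cases decide (2 ≤ x.arity) <;>
        cases decide (3 ≤ x.arity) <;>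
        simp only [cond_true, cond_false, sz_mk, sz_cons, sz_nil] <;> omega)
  exact this.fst

/-! ### Correctness of the parser -/

def TAxiom.item : TAxiom → Item
  | .conceptIncl A A' => (.conceptIncl, A, A', [])
  | .inclEx A p => (.inclEx, A, p, [])
  | .exIncl p A => (.exIncl, p, A, [])
  | .roleIncl p (.name s) => (.roleIncl, p, s, [])
  | .roleIncl p (.inv s) => (.roleInclInv, p, s, [])
  | .disjConcept A A' => (.disjConcept, A, A', [])
  | .disjRole p p' => (.disjRole, p, p', [])
  | .cri r s t => (.cri, r, s, t)

def Assertion.item : Assertion → Item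
  | .concept A a => (.conceptAssertion, A, a, [])
  | .role p a b => (.roleAssertion, p, a, b)

def InstanceQuery.item : InstanceQuery → Item
  | .concept A => (.conceptQuery, A, [], [])
  | .role p => (.roleQuery, p, [], [])

def indItem (a : IndName) : Item := (.ind, a, [], [])

def KB.items (K : KB) : List Item := K.tbox.map TAxiom.item ++ K.abox.map Assertion.item

def InstanceInput.items (i : InstanceInput) : List Item :=
  i.kb.items ++ i.query.item :: i.tuple.map indItem

theorem parseFrom_cons (x : Sym) (l : List Sym) (s : ParserState) :
    parseFrom (x :: l) s = parseStep x (parseFrom l s) := rfl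

theorem parseFrom_append (l l' : List Sym) (s : ParserState) :
    parseFrom (l ++ l') s = parseFrom l (parseFrom l' s) := List.foldr_append

theorem parseFrom_name (w : List Bool) (s : ParserState) :
    parseFrom (encodeName w) s = (s.1, w, s.2.1, s.2.2.1) := by
  induction w with
  | nil => rfl
  | cons b w ih =>
    have : parseFrom (encodeName (b :: w)) s = parseStep (.bit b) (parseFrom (encodeName w) s) := rfl
    rw [this, ih]; rfl

/-- The state `s` is arbitrary since a tag keeps only as many names as its arity and then clears the
names. Hence items can be parsed independently of what follows them. -/
theorem parseFrom_axiom (α : TAxiom) (s : ParserState) :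
    parseFrom (encodeAxiom α) s = (α.item :: s.1, [], [], []) := by
  rcases α with _ | _ | _ | ⟨_, _ | _⟩ | _ | _ | _ <;>
  simp only [encodeAxiom, parseFrom_cons, parseFrom_append, parseFrom_name] <;> rfl

theorem parseFrom_assertion (α : Assertion) (s : ParserState) :
    parseFrom (encodeAssertion α) s = (α.item :: s.1, [], [], []) := by
  cases α <;> simp only [encodeAssertion, parseFrom_cons, parseFrom_append, parseFrom_name] <;> rfl

theorem parseFrom_query (q : InstanceQuery) (s : ParserState) :
    parseFrom (encodeQuery q) s = (q.item :: s.1, [], [], []) := by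
  cases q <;> simp only [encodeQuery, parseFrom_cons, parseFrom_name] <;> rfl

theorem parseFrom_ind (a : IndName) (s : ParserState) :
    parseFrom (encodeInd a) s = (indItem a :: s.1, [], [], []) := by
  simp only [encodeInd, parseFrom_cons, parseFrom_name]; rfl

theorem parseFrom_list {α : Type} {enc : α → List Sym} {item : α → Item}
    (h : ∀ a s, parseFrom (enc a) s = (item a :: s.1, [], [], [])) (l : List α) (s : ParserState) :
    (parseFrom (encodeList enc l) s).1 = l.map item ++ s.1 := by
  induction l with
  | nil => rfl
  | cons a l ih =>
    have : encodeList enc (a :: l) = enc a ++ encodeList enc l := by simp [encodeList]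
    rw [this, parseFrom_append, h, ih, List.map_cons, List.cons_append]

theorem parse_KB (K : KB) : parse (encodeKB K) = K.items := by
  simp [parse, encodeKB, parseFrom_append, parseFrom_list parseFrom_axiom,
    parseFrom_list parseFrom_assertion, KB.items]

theorem parse_instance (i : InstanceInput) : parse (encodeInstance i) = i.items := by
  simp [parse, encodeInstance, encodeKB, parseFrom_append, parseFrom_list parseFrom_axiom,
    parseFrom_list parseFrom_assertion, parseFrom_list parseFrom_ind, parseFrom_query, KB.items,
    InstanceInput.items]

end DLLite

namespace DLLite

/-! ### The saturation is a fixed point -/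

theorem mem_allElements {N : List (List Bool)} {x : Element} :
    x ∈ allElements N ↔ x.2.1 ∈ N ∧ x.2.2 ∈ N := by
  rcases x with ⟨k, a, p⟩
  simp only [allElements, List.mem_flatMap, List.mem_map, Prod.mk.injEq]
  constructor
  · rintro ⟨_, _, _, h, _, h', rfl, rfl, rfl⟩
    exact ⟨h, h'⟩
  · rintro ⟨h, h'⟩
    exact ⟨k, by fin_cases k <;> simp, a, h, p, h', rfl, rfl, rfl⟩

theorem mem_allFacts {N : List (List Bool)} {φ : Fact} :
    φ ∈ allFacts N ↔ φ.2.1 ∈ N ∧ φ.2.2.1 ∈ allElements N ∧ φ.2.2.2 ∈ allElements N := by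
  rcases φ with ⟨b, A, x, y⟩
  simp only [allFacts, List.mem_flatMap, List.mem_map, Prod.mk.injEq]
  constructor
  · rintro ⟨_, _, _, h, _, h', _, h'', rfl, rfl, rfl, rfl⟩
    exact ⟨h, h', h''⟩
  · rintro ⟨h, h', h''⟩
    exact ⟨b, by cases b <;> simp, A, h, x, h', y, h'', rfl, rfl, rfl, rfl⟩

theorem derivable_iff {its : List Item} {F : List Fact} {φ : Fact} :
    derivable its F φ = true ↔ (∃ it ∈ its, asserts it φ = true) ∨
      ∃ it ∈ its, ∃ ψ ∈ F, ∃ ψ' ∈ F, entails it ψ ψ' φ = true := by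
  simp [derivable]

theorem clash_iff {its : List Item} {F : List Fact} :
    clash its F = true ↔ ∃ it ∈ its, ∃ ψ ∈ F, ∃ ψ' ∈ F, conflicts it ψ ψ' = true := by
  simp [clash]

theorem derivable_mono {its : List Item} {F G : List Fact} (h : F ⊆ G) {φ : Fact}
    (hφ : derivable its F φ = true) : derivable its G φ = true := by
  rw [derivable_iff] at hφ ⊢
  rcases hφ with hφ | ⟨it, hit, ψ, hψ, ψ', hψ', e⟩
  · exact .inl hφ
  · exact .inr ⟨it, hit, ψ, h hψ, ψ', h hψ', e⟩

theorem foldl_const_eq_iterate {α β : Type} (f : β → β) (l : List α) :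
    ∀ b, l.foldl (fun b _ => f b) b = f^[l.length] b := by
  induction l with
  | nil => intro b; rfl
  | cons a l ih => intro b; exact ih (f b)

/-- An iteration of filters whose conditions are monotone becomes stationary. -/
theorem isFixedPt_iterate_filter {α : Type} (U : List α) (p : List α → α → Bool)
    (hp : ∀ F G : List α, F ⊆ G → ∀ x, p F x = true → p G x = true) :
    U.filter (p ((fun F => U.filter (p F))^[U.length] [])) =
      (fun F => U.filter (p F))^[U.length] [] := by
  set f : List α → List α := fun F => U.filter (p F) with hf
  have mono : ∀ F G : List α, F ⊆ G → List.Sublist (f F) (f G) := fun F G h =>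
    List.monotone_filter_right U (hp F G h)
  -- All iterates are filters of the same list, so inclusion gives sublists, and sublists of equal
  -- length are equal.
  have step : ∀ i, List.Sublist (f^[i] []) (f^[i + 1] []) := by
    intro i
    induction i with
    | zero => simp
    | succ i ih =>
      rw [Function.iterate_succ_apply', Function.iterate_succ_apply' f (i + 1)]
      exact mono _ _ ih.subset
  by_contra hne
  have stat : ∀ i, f^[i + 1] [] = f^[i] [] → ∀ k, f^[i + k] [] = f^[i] [] := by
    intro i h k
    induction k with
    | zero => rfl
    | succ k ih =>
      rw [← add_assoc, Function.iterate_succ_apply', ih, ← Function.iterate_succ_apply' f, h]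
  -- Without a repetition each round adds an element, which is impossible for more than `U.length`
  -- rounds; an earlier repetition would persist up to round `U.length`.
  have len : ∀ i ≤ U.length + 1, i ≤ (f^[i] []).length := by
    intro i
    induction i with
    | zero => simp
    | succ i ih =>
      intro hi
      have h₁ := ih (by omega)
      have h₂ := (step i).length_le
      by_contra hlt
      have e : f^[i] [] = f^[i + 1] [] := (step i).eq_of_length (by omega)
      apply hne
      have := stat i e.symm (U.length - i)
      rw [Nat.add_sub_cancel' (by omega)] at this
      rw [this]
      exact (Function.iterate_succ_apply' f i []).symm.trans e.symm
  have h := len (U.length + 1) le_rfl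
  rw [Function.iterate_succ_apply'] at h
  have : (f (f^[U.length] [])).length ≤ U.length := List.length_filter_le _ _
  omega

theorem consequences_saturation (its : List Item) :
    consequences its (saturation its) = saturation its := by
  have h := isFixedPt_iterate_filter (allFacts (itemNames its)) (derivable its)
    fun F G hFG x hx => derivable_mono hFG hx
  have e : saturation its =
      (fun F => (allFacts (itemNames its)).filter (derivable its F))^[
        (allFacts (itemNames its)).length] [] := foldl_const_eq_iterate (consequences its) _ _
  rw [e]
  exact h

/-- Induction on the derivation of a fact. -/
theorem saturation_induction {its : List Item} {P : Fact → Prop}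
    (h₁ : ∀ it ∈ its, ∀ φ, asserts it φ = true → P φ)
    (h₂ : ∀ it ∈ its, ∀ ψ ψ' φ, P ψ → P ψ' → entails it ψ ψ' φ = true → P φ) :
    ∀ φ ∈ saturation its, P φ := by
  have key : ∀ (l : List Fact) (F : List Fact), (∀ φ ∈ F, P φ) →
      ∀ φ ∈ l.foldl (fun F _ => consequences its F) F, P φ := by
    intro l
    induction l with
    | nil => intro F hF; exact hF
    | cons a l ih =>
      intro F hF
      refine ih _ fun φ hφ => ?_
      rcases derivable_iff.1 (List.mem_filter.1 hφ).2 with ⟨it, hit, e⟩ | ⟨it, hit, ψ, hψ, ψ', hψ', e⟩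
      · exact h₁ it hit φ e
      · exact h₂ it hit ψ ψ' φ (hF ψ hψ) (hF ψ' hψ') e
  exact key _ [] (by simp)

theorem mem_saturation {its : List Item} {φ : Fact} :
    φ ∈ saturation its ↔ φ ∈ allFacts (itemNames its) ∧ derivable its (saturation its) φ = true := by
  conv_lhs => rw [← consequences_saturation]
  exact List.mem_filter

theorem mem_itemNames {its : List Item} {it : Item} (h : it ∈ its) :
    [] ∈ itemNames its ∧ it.2.1 ∈ itemNames its ∧ it.2.2.1 ∈ itemNames its ∧
      it.2.2.2 ∈ itemNames its := by
  have h' : ∀ n ∈ [it.2.1, it.2.2.1, it.2.2.2], n ∈ itemNames its := fun n hn =>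
    List.mem_cons_of_mem _ (List.mem_flatMap.2 ⟨it, h, hn⟩)
  exact ⟨List.mem_cons_self, h' _ (by simp), h' _ (by simp), h' _ (by simp)⟩

theorem mem_saturation_of_asserts {its : List Item} {it : Item} (h : it ∈ its) {φ : Fact}
    (hφ : asserts it φ = true) : φ ∈ saturation its := by
  refine mem_saturation.2 ⟨?_, derivable_iff.2 (.inl ⟨it, h, hφ⟩)⟩
  have := mem_itemNames h
  simp only [asserts, Bool.or_eq_true, Bool.and_eq_true, beq_iff_eq] at hφ
  rcases hφ with ⟨-, rfl⟩ | ⟨-, rfl⟩ <;> simp_all [mem_allFacts, mem_allElements, Element.ind]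

/-- The saturation is a fixed point, so it only remains to see that rules do not leave the finite
set of candidates: every name in a conclusion comes from the item or a premise. -/
theorem mem_saturation_of_entails {its : List Item} {it : Item} (h : it ∈ its) {ψ ψ' φ : Fact}
    (hψ : ψ ∈ saturation its) (hψ' : ψ' ∈ saturation its) (hφ : entails it ψ ψ' φ = true) :
    φ ∈ saturation its := by
  refine mem_saturation.2 ⟨?_, derivable_iff.2 (.inr ⟨it, h, ψ, hψ, ψ', hψ', hφ⟩)⟩
  have := mem_itemNames h
  have e := mem_allFacts.1 (mem_saturation.1 hψ).1
  have e' := mem_allFacts.1 (mem_saturation.1 hψ').1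
  simp only [entails, Bool.or_eq_true, Bool.and_eq_true, beq_iff_eq] at hφ
  rw [mem_allFacts]
  rcases hφ with ((((hφ | hφ) | hφ) | hφ) | hφ) | hφ <;> obtain ⟨-, rfl⟩ := hφ <;>
    simp_all [mem_allElements, Element.child]

/-! ### Items and knowledge bases -/

/-- The items consist of those of the knowledge base and of items of the query. -/
structure Represents (its : List Item) (K : KB) : Prop where
  tbox : ∀ α ∈ K.tbox, α.item ∈ its
  abox : ∀ α ∈ K.abox, α.item ∈ its
  cases : ∀ it ∈ its, (∃ α ∈ K.tbox, it = α.item) ∨ (∃ α ∈ K.abox, it = α.item) ∨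
    it.1 = .conceptQuery ∨ it.1 = .roleQuery ∨ it.1 = .ind

theorem represents_KB (K : KB) : Represents K.items K where
  tbox α h := List.mem_append_left _ (List.mem_map_of_mem h)
  abox α h := List.mem_append_right _ (List.mem_map_of_mem h)
  cases it h := by
    simp only [KB.items, List.mem_append, List.mem_map] at h
    rcases h with ⟨α, h, rfl⟩ | ⟨α, h, rfl⟩
    · exact .inl ⟨α, h, rfl⟩
    · exact .inr (.inl ⟨α, h, rfl⟩)

theorem represents_instance (i : InstanceInput) : Represents i.items i.kb where
  tbox α h := List.mem_append_left _ ((represents_KB i.kb).tbox α h)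
  abox α h := List.mem_append_left _ ((represents_KB i.kb).abox α h)
  cases it h := by
    simp only [InstanceInput.items, List.mem_append, List.mem_cons, List.mem_map] at h
    rcases h with h | rfl | ⟨a, -, rfl⟩
    · exact (represents_KB i.kb).cases it h
    · cases i.query <;> simp [InstanceQuery.item]
    · simp [indItem]

/-- A property of all facts of the saturation. -/
theorem Represents.induction {its : List Item} {K : KB} (h : Represents its K) {P : Fact → Prop}
    (concept : ∀ A a, .concept A a ∈ K.abox → P (false, A, Element.ind a, Element.ind a))
    (role : ∀ p a b, .role p a b ∈ K.abox → P (true, p, Element.ind a, Element.ind b))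
    (conceptIncl : ∀ A A' x y, .conceptIncl A A' ∈ K.tbox → P (false, A, x, y) →
      P (false, A', x, y))
    (inclEx : ∀ A p x y, .inclEx A p ∈ K.tbox → P (false, A, x, y) →
      P (true, p, x, x.child p))
    (exIncl : ∀ p A x y, .exIncl p A ∈ K.tbox → P (true, p, x, y) → P (false, A, x, x))
    (roleIncl : ∀ p s x y, .roleIncl p (.name s) ∈ K.tbox → P (true, p, x, y) → P (true, s, x, y))
    (roleInclInv : ∀ p s x y, .roleIncl p (.inv s) ∈ K.tbox → P (true, p, x, y) →
      P (true, s, y, x))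
    (cri : ∀ r s t x y z, .cri r s t ∈ K.tbox → y.1 = 0 → z.1 = 0 → P (true, r, x, y) →
      P (true, s, y, z) → P (true, t, x, z)) :
    ∀ φ ∈ saturation its, P φ := by
  refine saturation_induction (fun it hit φ hφ => ?_) fun it hit ψ ψ' φ hψ hψ' hφ => ?_
  · rcases h.cases it hit with ⟨α, hα, rfl⟩ | ⟨α, hα, rfl⟩ | e
    · rcases α with _ | _ | _ | ⟨_, _ | _⟩ | _ | _ | _ <;> simp [asserts, TAxiom.item] at hφ
    · cases α <;> simp [asserts, Assertion.item] at hφ <;> subst hφ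
      · exact concept _ _ hα
      · exact role _ _ _ hα
    · rcases e with e | e | e <;> simp [asserts, e] at hφ
  · obtain ⟨k, B, x, y⟩ := ψ
    obtain ⟨k', B', x', y'⟩ := ψ'
    rcases h.cases it hit with ⟨α, hα, rfl⟩ | ⟨α, hα, rfl⟩ | e
    · rcases α with _ | _ | _ | ⟨_, _ | _⟩ | _ | _ | _ <;>
        simp only [entails, TAxiom.item, Bool.or_eq_true, Bool.and_eq_true, beq_iff_eq,
          reduceCtorEq, false_and, or_false, false_or, true_and] at hφ
      · obtain ⟨⟨rfl, rfl⟩, rfl⟩ := hφ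
        exact conceptIncl _ _ _ _ hα hψ
      · obtain ⟨⟨rfl, rfl⟩, rfl⟩ := hφ
        exact inclEx _ _ _ _ hα hψ
      · obtain ⟨⟨rfl, rfl⟩, rfl⟩ := hφ
        exact exIncl _ _ _ _ hα hψ
      · obtain ⟨⟨rfl, rfl⟩, rfl⟩ := hφ
        exact roleIncl _ _ _ _ hα hψ
      · obtain ⟨⟨rfl, rfl⟩, rfl⟩ := hφ
        exact roleInclInv _ _ _ _ hα hψ
      · obtain ⟨⟨⟨⟨⟨⟨⟨rfl, rfl⟩, rfl⟩, rfl⟩, rfl⟩, e⟩, e'⟩, rfl⟩ := hφ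
        exact cri _ _ _ _ _ _ hα e e' hψ hψ'
    · cases α <;> simp [entails, Assertion.item] at hφ
    · rcases e with e | e | e <;> simp [entails, e] at hφ

/-! ### Soundness -/

section

variable {Δ : Type} (I : Interp Δ)

open Classical in
/-- A successor of an individual for a role, if there is one. -/
noncomputable def Interp.witness (a p : List Bool) : Δ :=
  if h : ∃ d, (I.ind a, d) ∈ I.roleName p then h.choose else I.ind a

/-- The elements of an interpretation that correspond to an element of the canonical model. -/
def Interp.Realizes (x : Element) (d : Δ) : Prop :=
  if x.1 = 0 then d = I.ind x.2.1
  else if x.1 = 1 then d = I.witness x.2.1 x.2.2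
  else ∃ e, (e, d) ∈ I.roleName x.2.2

/-- The pairs of elements of an interpretation that correspond to a pair of elements of the
canonical model, provided that the latter are connected by a role. -/
def Interp.Linked (x y : Element) (d d' : Δ) : Prop :=
  ((x.1 ≤ 1 ∧ y.1 ≤ 1) ∧ I.Realizes x d ∧ I.Realizes y d') ∨
  ((x.1 ≠ 0 ∧ y.1 = nextLevel x.1) ∧ (d, d') ∈ I.roleName y.2.2) ∨
  ((y.1 ≠ 0 ∧ x.1 = nextLevel y.1) ∧ (d', d) ∈ I.roleName x.2.2)

variable {I}

theorem Interp.realizes_ind {a : List Bool} {d : Δ} : I.Realizes (Element.ind a) d ↔ d = I.ind a := by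
  simp [Realizes, Element.ind]

theorem Interp.Linked.symm {x y : Element} {d d' : Δ} (h : I.Linked x y d d') :
    I.Linked y x d' d := by
  unfold Linked at *
  tauto

/-- Level 0 is not the successor of any level, so no clause for deeper tree edges applies. -/
theorem Interp.linked_zero {x y : Element} (hy : y.1 = 0) {d d' : Δ} :
    I.Linked x y d d' ↔ x.1 ≤ 1 ∧ I.Realizes x d ∧ I.Realizes y d' := by
  have h : ∀ k : Fin 5, ¬ (0 = nextLevel k) := by decide
  simp [Linked, hy, h]

/-- The meaning of a fact in an interpretation. -/
structure Interp.RoleFact (I : Interp Δ) (p : List Bool) (x y : Element) : Prop where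
  mem : ∀ d d', I.Linked x y d d' → (d, d') ∈ I.roleName p
  left : ∀ d, I.Realizes x d → ∃ d', I.Linked x y d d'
  right : ∀ d', I.Realizes y d' → ∃ d, I.Linked x y d d'
  exists_left : ∃ d, I.Realizes x d
  exists_right : ∃ d, I.Realizes y d

structure Interp.ConceptFact (I : Interp Δ) (A : List Bool) (x : Element) : Prop where
  mem : ∀ d, I.Realizes x d → d ∈ I.concept A
  exists_realizes : ∃ d, I.Realizes x d

def Interp.Satisfies (I : Interp Δ) (φ : Fact) : Prop :=
  if φ.1 = true then I.RoleFact φ.2.1 φ.2.2.1 φ.2.2.2 else I.ConceptFact φ.2.1 φ.2.2.1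

theorem Interp.RoleFact.of_ind {p a b : List Bool} (h : (I.ind a, I.ind b) ∈ I.roleName p) :
    I.RoleFact p (Element.ind a) (Element.ind b) := by
  have h0 : (Element.ind b).1 = 0 := rfl
  have h1 : (Element.ind a).1 ≤ 1 := by simp [Element.ind]
  constructor <;> simp [linked_zero h0, realizes_ind, h, h1]

/-- Below an individual the edge is read as the single pair of the individual and its chosen
witness. Below any other element it is read as all of `p`, so membership is immediate and the
concept fact provides a successor for every realizer of `x`. -/
theorem Interp.RoleFact.child {A p : List Bool} {x : Element} (hx : I.ConceptFact A x)
    (hA : I.concept A ⊆ I.ex p) : I.RoleFact p x (x.child p) := by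
  obtain ⟨k, a, q⟩ := x
  by_cases hk : k = 0
  · subst hk
    have hw : (I.ind a, I.witness a p) ∈ I.roleName p := by
      have : ∃ d, (I.ind a, d) ∈ I.roleName p := hA (hx.mem _ (by simp [Realizes]))
      rw [witness, dif_pos this]
      exact this.choose_spec
    have key : ∀ d d', I.Linked (0, a, q) (Element.child (0, a, q) p) d d' ↔
        d = I.ind a ∧ d' = I.witness a p := by
      intro d d'
      simp [Linked, Element.child, Realizes, show nextLevel 0 = 1 from rfl,
        show nextLevel 1 = 2 from rfl]
    have h₁ : ∀ d, I.Realizes (0, a, q) d ↔ d = I.ind a := fun d => by simp [Realizes]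
    have h₂ : ∀ d, I.Realizes (Element.child (0, a, q) p) d ↔ d = I.witness a p := fun d => by
      simp [Realizes, Element.child, show nextLevel 0 = 1 from rfl]
    constructor <;> simp [key, h₁, h₂, hw]
  · have h₁ : ∀ k : Fin 5, k ≠ 0 → ¬ nextLevel k ≤ 1 ∧ nextLevel k ≠ 0 ∧ nextLevel k ≠ 1 := by
      decide
    -- Excludes reading the pair as an edge in the opposite direction.
    have h₂ : ∀ k : Fin 5, k ≠ nextLevel (nextLevel k) := by decide
    obtain ⟨h₁, h₃, h₄⟩ := h₁ k hk
    have key : ∀ d d', I.Linked (k, a, q) (Element.child (k, a, q) p) d d' ↔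
        (d, d') ∈ I.roleName p := by
      intro d d'
      constructor
      · rintro (⟨⟨-, h⟩, -⟩ | ⟨-, h⟩ | ⟨⟨-, h⟩, -⟩)
        · exact absurd h h₁
        · exact h
        · exact absurd h (h₂ k)
      · exact fun h => .inr (.inl ⟨⟨hk, rfl⟩, h⟩)
    have hr : ∀ d, I.Realizes (Element.child (k, a, q) p) d ↔ ∃ e, (e, d) ∈ I.roleName p := by
      intro d; simp [Realizes, Element.child, h₃, h₄]
    obtain ⟨d, hd⟩ := hx.exists_realizes
    obtain ⟨d', hd'⟩ := hA (hx.mem d hd)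
    constructor
    · exact fun d d' h => (key d d').1 h
    · intro d hd
      obtain ⟨d', hd'⟩ := hA (hx.mem d hd)
      exact ⟨d', (key d d').2 hd'⟩
    · intro d' hd'
      obtain ⟨e, he⟩ := (hr d').1 hd'
      exact ⟨e, (key e d').2 he⟩
    · exact ⟨d, hd⟩
    · exact ⟨d', (hr d').2 ⟨d, hd'⟩⟩

/-- With an individual as second component, being linked is just the product of the two realizer
sets. So one realizer of `y` serves as the middle point for all pairs. -/
theorem Interp.RoleFact.comp {r s t : List Bool} {x y z : Element} (hy : y.1 = 0) (hz : z.1 = 0)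
    (h : I.SatAxiom (.cri r s t)) (hr : I.RoleFact r x y) (hs : I.RoleFact s y z) :
    I.RoleFact t x z := by
  have hx : x.1 ≤ 1 := by
    -- A role fact is never vacuous, and an individual is linked only to elements of level at most
    -- 1.
    obtain ⟨d, hd⟩ := hr.exists_left
    obtain ⟨d', hd'⟩ := hr.left d hd
    exact ((linked_zero hy).1 hd').1
  have hy' : y.1 ≤ 1 := by simp [hy]
  obtain ⟨e, he⟩ := hr.exists_right
  obtain ⟨c, hc⟩ := hs.exists_right
  obtain ⟨b, hb⟩ := hr.exists_left
  constructor
  · intro d d' hd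
    obtain ⟨-, hd, hd'⟩ := (linked_zero hz).1 hd
    exact h d e d' (hr.mem _ _ ((linked_zero hy).2 ⟨hx, hd, he⟩))
      (hs.mem _ _ ((linked_zero hz).2 ⟨hy', he, hd'⟩))
  · exact fun d hd => ⟨c, (linked_zero hz).2 ⟨hx, hd, hc⟩⟩
  · exact fun d hd => ⟨b, (linked_zero hz).2 ⟨hx, hb, hd⟩⟩
  · exact ⟨b, hb⟩
  · exact ⟨c, hc⟩

/-- All facts of the saturation hold in every model. -/
theorem satisfies_of_mem_saturation {its : List Item} {K : KB} (h : Represents its K)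
    (hI : I.IsModel K) : ∀ φ ∈ saturation its, I.Satisfies φ := by
  refine h.induction ?_ ?_ ?_ ?_ ?_ ?_ ?_ ?_ <;>
    simp only [Interp.Satisfies, if_true, Bool.false_eq_true, if_false]
  · intro A a hA
    exact ⟨fun d hd => Interp.realizes_ind.1 hd ▸ hI.2 _ hA, _, Interp.realizes_ind.2 rfl⟩
  · intro p a b hp
    exact .of_ind (hI.2 _ hp)
  · intro A A' x y hA hx
    exact ⟨fun d hd => hI.1 _ hA (hx.mem d hd), hx.exists_realizes⟩
  · intro A p x y hA hx
    exact .child hx (hI.1 _ hA)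
  · intro p A x y hp hx
    refine ⟨fun d hd => hI.1 _ hp ?_, hx.exists_left⟩
    obtain ⟨d', hd'⟩ := hx.left d hd
    exact ⟨d', hx.mem _ _ hd'⟩
  · intro p s x y hp hx
    exact ⟨fun d d' hd => hI.1 _ hp (hx.mem d d' hd), hx.left, hx.right, hx.exists_left,
      hx.exists_right⟩
  · intro p s x y hp hx
    refine ⟨fun d d' hd => hI.1 _ hp (hx.mem d' d hd.symm), fun d hd => ?_, fun d hd => ?_,
      hx.exists_right, hx.exists_left⟩
    · obtain ⟨d', hd'⟩ := hx.right d hd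
      exact ⟨d', hd'.symm⟩
    · obtain ⟨d', hd'⟩ := hx.left d hd
      exact ⟨d', hd'.symm⟩
  · intro r s t x y z ht hy hz hr hs
    exact .comp hy hz (hI.1 _ ht) hr hs

theorem concept_of_mem_saturation {its : List Item} {K : KB} (h : Represents its K)
    (hI : I.IsModel K) {A a : List Bool}
    (hA : (false, A, Element.ind a, Element.ind a) ∈ saturation its) : I.ind a ∈ I.concept A := by
  have : I.ConceptFact A (Element.ind a) := satisfies_of_mem_saturation h hI _ hA
  exact this.mem _ (Interp.realizes_ind.2 rfl)

theorem role_of_mem_saturation {its : List Item} {K : KB} (h : Represents its K)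
    (hI : I.IsModel K) {p a b : List Bool}
    (hp : (true, p, Element.ind a, Element.ind b) ∈ saturation its) :
    (I.ind a, I.ind b) ∈ I.roleName p := by
  have : I.RoleFact p (Element.ind a) (Element.ind b) := satisfies_of_mem_saturation h hI _ hp
  exact this.mem _ _ ((Interp.linked_zero rfl).2
    ⟨by simp [Element.ind], Interp.realizes_ind.2 rfl, Interp.realizes_ind.2 rfl⟩)

/-- Conflicting facts concern the same element or pair, hence the same realizers, and these exist:
they would violate the disjointness axiom in the model. -/
theorem clash_eq_false {its : List Item} {K : KB} (h : Represents its K)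
    (hI : I.IsModel K) : clash its (saturation its) = false := by
  rw [← Bool.not_eq_true, clash_iff]
  rintro ⟨it, hit, ⟨k, B, x, y⟩, hψ, ψ', hψ', e⟩
  have s := satisfies_of_mem_saturation h hI _ hψ
  have s' := satisfies_of_mem_saturation h hI _ hψ'
  rcases h.cases it hit with ⟨α, hα, rfl⟩ | ⟨α, hα, rfl⟩ | e'
  · have sat := hI.1 α hα
    rcases α with _ | _ | _ | ⟨_, _ | _⟩ | _ | _ | _ <;> simp [conflicts, TAxiom.item] at e
    · obtain ⟨⟨rfl, rfl⟩, rfl⟩ := e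
      replace s : I.ConceptFact _ _ := s
      replace s' : I.ConceptFact _ _ := s'
      obtain ⟨d, hd⟩ := s.exists_realizes
      exact (sat.subset ⟨s.mem d hd, s'.mem d hd⟩ : d ∈ (∅ : Set Δ))
    · obtain ⟨⟨rfl, rfl⟩, rfl⟩ := e
      replace s : I.RoleFact _ _ _ := s
      replace s' : I.RoleFact _ _ _ := s'
      obtain ⟨d, hd⟩ := s.exists_left
      obtain ⟨d', hd'⟩ := s.left d hd
      exact (sat.subset ⟨s.mem d d' hd', s'.mem d d' hd'⟩ : (d, d') ∈ (∅ : Set (Δ × Δ)))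
  · cases α <;> simp [conflicts, Assertion.item] at e
  · rcases e' with e' | e' | e' <;> simp [conflicts, e'] at e

end

/-! ### Completeness -/

/-- The interpretation in which exactly the given facts hold. -/
def interpOfFacts (F : List Fact) : Interp Element where
  ind := Element.ind
  ind_injective a b h := by simpa [Element.ind] using h
  concept A := {x | (false, A, x, x) ∈ F}
  roleName p := {z | (true, p, z.1, z.2) ∈ F}

/-- Simple roles connect only individuals, unless they have an existential subrole. -/
theorem simple_of_mem_saturation {its : List Item} {K : KB} (h : Represents its K) {S : Set Role}
    (hS : IsSimpleRoleSet S) (hT : IsHR S K.tbox) : ∀ φ ∈ saturation its, φ.1 = true →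
      Role.name φ.2.1 ∈ S → (φ.2.2.1.1 = 0 ∧ φ.2.2.2.1 = 0) ∨
        ∃ A t, TAxiom.inclEx A t ∈ K.tbox ∧ (SimpleSub S K.tbox (.name t) (.name φ.2.1) ∨
          SimpleSub S K.tbox (.name t) (.inv φ.2.1)) := by
  refine h.induction ?_ ?_ ?_ ?_ ?_ ?_ ?_ ?_ <;>
    simp only [reduceCtorEq, IsEmpty.forall_iff, implies_true, forall_const]
  · exact fun p a b _ _ => Or.inl ⟨rfl, rfl⟩
  · exact fun A p x hA _ => Or.inr ⟨A, p, hA, .inl .refl⟩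
  · intro p s x y hp ih hs
    -- An inclusion in `s` is also an inclusion of inverses in `s⁻`; both are simple inclusions
    -- because `S` is closed under inverses.
    have hs' : Role.inv s ∈ S := hS _ hs
    refine (ih (hT.2 _ _ hp hs)).imp_right ?_
    rintro ⟨A, t, hA, ht | ht⟩
    · exact ⟨A, t, hA, .inl (ht.tail ⟨hp, hs⟩)⟩
    · exact ⟨A, t, hA, .inr (ht.tail ⟨hp, hs'⟩)⟩
  · intro p s x y hp ih hs
    have hs' : Role.inv s ∈ S := hS _ hs
    refine (ih (hT.2 _ _ hp hs')).imp And.symm ?_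
    rintro ⟨A, t, hA, ht | ht⟩
    · exact ⟨A, t, hA, .inr (ht.tail ⟨hp, hs'⟩)⟩
    · exact ⟨A, t, hA, .inl (ht.tail ⟨hp, hs⟩)⟩
  -- The right-hand side of a CRI is not simple.
  · exact fun r s t x y z ht _ _ _ _ hs => absurd hs (hT.1 _ _ _ ht).2

/-- Being closed under the rules is what the inclusions demand, with `x.child p` as existential
witness. Only the CRIs need more, since their rule is restricted to individuals. -/
theorem isModel_interpOfFacts {its : List Item} {K : KB} (h : Represents its K)
    (hK : K.RecursionSafe) (hc : clash its (saturation its) = false) :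
    (interpOfFacts (saturation its)).IsModel K := by
  obtain ⟨S, hS, hT, hR⟩ := hK
  rw [← Bool.not_eq_true, clash_iff] at hc
  refine ⟨fun α hα => ?_, fun α hα => ?_⟩
  · have hit := h.tbox α hα
    rcases α with ⟨A, A'⟩ | ⟨A, p⟩ | ⟨p, A⟩ | ⟨p, s | s⟩ | ⟨A, A'⟩ | ⟨p, p'⟩ | ⟨r, s, t⟩
    · intro x hx
      exact mem_saturation_of_entails hit hx hx (by simp [entails, TAxiom.item])
    · intro x hx
      exact ⟨x.child p, mem_saturation_of_entails hit hx hx (by simp [entails, TAxiom.item])⟩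
    · rintro x ⟨y, hx⟩
      exact mem_saturation_of_entails hit hx hx (by simp [entails, TAxiom.item])
    · rintro ⟨x, y⟩ hx
      exact mem_saturation_of_entails hit hx hx (by simp [entails, TAxiom.item])
    · rintro ⟨x, y⟩ hx
      exact mem_saturation_of_entails hit hx hx (by simp [entails, TAxiom.item])
    · refine Set.eq_empty_iff_forall_notMem.2 fun x hx => hc ?_
      exact ⟨_, hit, _, hx.1, _, hx.2, by simp [conflicts, TAxiom.item]⟩
    · refine Set.eq_empty_iff_forall_notMem.2 fun x hx => hc ?_
      exact ⟨_, hit, _, hx.1, _, hx.2, by simp [conflicts, TAxiom.item]⟩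
    · intro x y z hx hy
      -- Either the `s`-edge joins individuals and the restricted rule applies, or condition (2) of
      -- recursion safety is violated.
      rcases simple_of_mem_saturation h hS hT _ hy rfl (hT.1 _ _ _ hα).1 with ⟨h₁, h₂⟩ | hex
      · replace h₁ : y.1 = 0 := h₁
        replace h₂ : z.1 = 0 := h₂
        exact mem_saturation_of_entails hit hx hy (by simp [entails, TAxiom.item, h₁, h₂])
      · exact absurd hex (hR _ _ _ hα).2
  · have hit := h.abox α hα
    cases α with
    | concept A a =>
      change (false, A, Element.ind a, Element.ind a) ∈ saturation its
      exact mem_saturation_of_asserts hit (by simp [asserts, Assertion.item])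
    | role p a b =>
      change (true, p, Element.ind a, Element.ind b) ∈ saturation its
      exact mem_saturation_of_asserts hit (by simp [asserts, Assertion.item])

/-! ### Deciding consistency and certain answers -/

theorem consistent_iff {its : List Item} {K : KB} (h : Represents its K) (hK : K.RecursionSafe) :
    K.Consistent ↔ clash its (saturation its) = false :=
  ⟨fun ⟨_, _, hI⟩ => clash_eq_false h hI, fun hc => ⟨_, _, isModel_interpOfFacts h hK hc⟩⟩

/-- If there is no clash, the canonical interpretation is itself a model, so what is certain holds
in it and is a derived fact. The converse is soundness. -/
theorem concept_certain_iff {its : List Item} {K : KB} (h : Represents its K)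
    (hK : K.RecursionSafe) (A a : List Bool) :
    (∀ (Δ : Type) (I : Interp Δ), I.IsModel K → I.ind a ∈ I.concept A) ↔
      clash its (saturation its) = true ∨
        (false, A, Element.ind a, Element.ind a) ∈ saturation its := by
  constructor
  · intro hall
    cases hc : clash its (saturation its) with
    | true => exact .inl rfl
    | false => exact .inr (hall _ _ (isModel_interpOfFacts h hK hc))
  · rintro (hc | hA) Δ I hI
    · rw [clash_eq_false h hI] at hc; cases hc
    · exact concept_of_mem_saturation h hI hA

theorem role_certain_iff {its : List Item} {K : KB} (h : Represents its K)
    (hK : K.RecursionSafe) (p a b : List Bool) :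
    (∀ (Δ : Type) (I : Interp Δ), I.IsModel K → (I.ind a, I.ind b) ∈ I.roleName p) ↔
      clash its (saturation its) = true ∨
        (true, p, Element.ind a, Element.ind b) ∈ saturation its := by
  constructor
  · intro hall
    cases hc : clash its (saturation its) with
    | true => exact .inl rfl
    | false => exact .inr (hall _ _ (isModel_interpOfFacts h hK hc))
  · rintro (hc | hA) Δ I hI
    · rw [clash_eq_false h hI] at hc; cases hc
    · exact role_of_mem_saturation h hI hA

theorem occurs_iff {its : List Item} {K : KB} (h : Represents its K) (a : List Bool) :
    occurs its a = true ↔ a ∈ K.abox.inds := by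
  simp only [occurs, List.any_eq_true, ABox.inds]
  constructor
  · rintro ⟨it, hit, e⟩
    rcases h.cases it hit with ⟨α, hα, rfl⟩ | ⟨α, hα, rfl⟩ | e'
    · rcases α with _ | _ | _ | ⟨_, _ | _⟩ | _ | _ | _ <;> simp [TAxiom.item] at e
    · refine ⟨α, hα, ?_⟩
      cases α <;> simp [Assertion.item] at e
      · exact e.symm
      · exact e.imp Eq.symm Eq.symm
    · rcases e' with e' | e' | e' <;> simp [e'] at e
  · rintro ⟨α, hα, ha⟩
    refine ⟨_, h.abox α hα, ?_⟩
    cases α with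
    | concept A b =>
      obtain rfl : a = b := ha
      simp [Assertion.item]
    | role p b c =>
      replace ha : a = b ∨ a = c := ha
      rcases ha with rfl | rfl <;> simp [Assertion.item]

theorem queryInds_items (i : InstanceInput) : queryInds i.items = i.tuple := by
  have h₁ : ∀ α : TAxiom, (α.item.1 == Sym.ind) = false := by
    rintro (_ | _ | _ | ⟨_, _ | _⟩ | _ | _ | _) <;> rfl
  have h₂ : ∀ α : Assertion, (α.item.1 == Sym.ind) = false := by
    rintro (_ | _) <;> rfl
  have h₃ : ∀ α : InstanceQuery, (α.item.1 == Sym.ind) = false := by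
    rintro (_ | _) <;> rfl
  have h₄ : ∀ a, ((indItem a).1 == Sym.ind) = true := fun _ => rfl
  simp [queryInds, InstanceInput.items, KB.items, List.filter_append, List.filter_map,
    Function.comp_def, h₁, h₂, h₃, h₄]
  simp [indItem]

theorem mem_cert_concept {K : KB} {A : ConceptName} {as : List IndName} :
    as ∈ K.cert (.concept A) ↔ ∃ a, as = [a] ∧ a ∈ K.abox.inds ∧
      ∀ (Δ : Type) (I : Interp Δ), I.IsModel K → I.ind a ∈ I.concept A := by
  constructor
  · rintro ⟨hl, ha, h⟩
    obtain ⟨a, rfl⟩ := List.length_eq_one_iff.1 hl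
    refine ⟨a, rfl, ha a (by simp), fun Δ I hI => ?_⟩
    obtain ⟨d, e, hd⟩ := h Δ I hI
    obtain rfl : I.ind a = d := by simpa using e
    exact hd
  · rintro ⟨a, rfl, ha, h⟩
    exact ⟨rfl, by simpa using ha, fun Δ I hI => ⟨_, rfl, h Δ I hI⟩⟩

theorem mem_cert_role {K : KB} {p : RoleName} {as : List IndName} :
    as ∈ K.cert (.role p) ↔ ∃ a b, as = [a, b] ∧ a ∈ K.abox.inds ∧ b ∈ K.abox.inds ∧
      ∀ (Δ : Type) (I : Interp Δ), I.IsModel K → (I.ind a, I.ind b) ∈ I.roleName p := by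
  constructor
  · rintro ⟨hl, ha, h⟩
    obtain ⟨a, b, rfl⟩ := List.length_eq_two.1 hl
    refine ⟨a, b, rfl, ha a (by simp), ha b (by simp), fun Δ I hI => ?_⟩
    obtain ⟨d, d', e, hd⟩ := h Δ I hI
    obtain ⟨rfl, rfl⟩ : I.ind a = d ∧ I.ind b = d' := by simpa using e
    exact hd
  · rintro ⟨a, b, rfl, ha, hb, h⟩
    exact ⟨rfl, by simpa using ⟨ha, hb⟩, fun Δ I hI => ⟨_, _, rfl, h Δ I hI⟩⟩

theorem eq_query_item {i : InstanceInput} {q : Item} (hq : q ∈ i.items)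
    (h : q.1 = .conceptQuery ∨ q.1 = .roleQuery) : q = i.query.item := by
  simp only [InstanceInput.items, KB.items, List.mem_append, List.mem_cons, List.mem_map] at hq
  rcases hq with (⟨α, -, rfl⟩ | ⟨α, -, rfl⟩) | rfl | ⟨a, -, rfl⟩
  · rcases α with _ | _ | _ | ⟨_, _ | _⟩ | _ | _ | _ <;> simp [TAxiom.item] at h
  · cases α <;> simp [Assertion.item] at h
  · rfl
  · simp [indItem] at h

/-- The items contain exactly one query, and the individuals of a tuple of the right length can be
searched for within the tuple. -/
theorem answer_iff (i : InstanceInput) (hK : i.kb.RecursionSafe) :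
    answer i.items (saturation i.items) (queryInds i.items) = true ↔
      i.tuple ∈ i.kb.cert i.query := by
  have h := represents_instance i
  have hmem : i.query.item ∈ i.items := List.mem_append_right _ List.mem_cons_self
  rw [queryInds_items]
  simp only [answer, List.any_eq_true, Bool.or_eq_true, Bool.and_eq_true, beq_iff_eq,
    exists_eq_right, occurs_iff h]
  cases hq : i.query with
  | concept A =>
    rw [hq] at hmem
    simp only [mem_cert_concept, concept_certain_iff h hK]
    constructor
    · rintro ⟨q, hqm, ⟨e, a, -, ⟨ht, ha⟩, hc⟩ | ⟨e, -⟩⟩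
      · obtain rfl := (eq_query_item hqm (.inl e)).trans (congrArg _ hq)
        exact ⟨a, ht, ha, hc⟩
      · obtain rfl := (eq_query_item hqm (.inr e)).trans (congrArg _ hq)
        cases e
    · rintro ⟨a, ht, ha, hc⟩
      exact ⟨_, hmem, .inl ⟨rfl, a, by simp [ht], ⟨ht, ha⟩, hc⟩⟩
  | role p =>
    rw [hq] at hmem
    simp only [mem_cert_role, role_certain_iff h hK]
    constructor
    · rintro ⟨q, hqm, ⟨e, -⟩ | ⟨e, a, -, b, -, ⟨⟨ht, ha⟩, hb⟩, hc⟩⟩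
      · obtain rfl := (eq_query_item hqm (.inl e)).trans (congrArg _ hq)
        cases e
      · obtain rfl := (eq_query_item hqm (.inr e)).trans (congrArg _ hq)
        exact ⟨a, b, ht, ha, hb, hc⟩
    · rintro ⟨a, b, ht, ha, hb, hc⟩
      exact ⟨_, hmem, .inr ⟨rfl, a, by simp [ht], b, by simp [ht], ⟨⟨ht, ha⟩, hb⟩, hc⟩⟩

/-! ### Solvability in polynomial time -/

theorem solvable_consistency :
    SolvableInPolyTime encodeKB (fun K => K.RecursionSafe) (fun K => K.Consistent) := by
  refine ⟨_, PolyComputable.computableInPolyTime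
    (p := fun l => !clash (parse l) (saturation (parse l))) ?_ encodeKB, fun K hK => ?_⟩
  · have h₁ := polyComputable_parse
    have h₂ := polyComputable_saturation.comp h₁
    fun_prop
  · simp only [parse_KB, Bool.not_eq_true']
    exact (consistent_iff (represents_KB K) hK).symm

theorem solvable_instanceQueries :
    SolvableInPolyTime encodeInstance (fun i => i.kb.RecursionSafe)
      (fun i => i.tuple ∈ i.kb.cert i.query) := by
  refine ⟨_, PolyComputable.computableInPolyTime
    (p := fun l => answer (parse l) (saturation (parse l)) (queryInds (parse l))) ?_
    encodeInstance, fun i hi => ?_⟩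
  · have h₁ := polyComputable_parse
    exact polyComputable_answer h₁ (polyComputable_saturation.comp h₁)
      (polyComputable_queryInds.comp h₁)
  · simp only [parse_instance]
    exact answer_iff i hi

end DLLite

theorem mainTheorem7 :
    DLLite.SolvableInPolyTime DLLite.encodeKB
      (fun K => K.RecursionSafe) (fun K => K.Consistent) ∧
    DLLite.SolvableInPolyTime DLLite.encodeInstance
      (fun i => i.kb.RecursionSafe) (fun i => i.tuple ∈ i.kb.cert i.query) :=
  ⟨DLLite.solvable_consistency, DLLite.solvable_instanceQueries⟩
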